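/- **Setting.** For $\beta>0$ let $K=K_\beta$ be the Klein bottle $\mathbb C/\langle\sigma,t\rangle$, where $\sigma(z)=\bar z+\pi$ and $t(z)=z+2i\beta$, and let $g_\beta$ be the flat metric induced on it by the Euclidean metric of $\mathbb C$. Riemannian metrics on $K$ are only required to be continuous. For such a metric $g$, let $\mathrm{vol}(g)$ be its area, let $l_v(g)$ be the least length (infimum) of a closed curve in the free homotopy class of $t$, and let $l_\sigma(g)$ be the least length of a closed curve closed by a glide reflection, that is, of a curve in the free homotopy class of $\sigma$ or in that of $t\sigma$ (every $t^k\sigma$, $k\in\mathbb Z$, is conjugate to one of these two). For $b>0$, a metric of the form $f(v)^2du^2+dv^2$, with $f$ continuous, positive, even and $2b$-periodic, is considered on the quotient of the $(u,v)$-plane by $(u,v)\mapsto(u+\pi,-v)$ and $(u,v)\mapsto(u,v+4b)$. It is called *spherical with parameter $b\in(0,\pi/2)$* if $f(v)=\cos v$ for $|v|\le b$, and *flat-spherical with parameters $\omega<b$*, where $\omega\in(0,\pi/2)$, if $f(v)=\cos v$ for $|v|\le\omega$ and $f(v)=\cos\omega$ for $\omega\le|v|\le b$. A metric on $K$ that is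 isometric to one of these is called by the same name. **Theorem.** Let $b_0\in(0,\pi/2)$ be such that $\tan b_0=2b_0$, and let $\beta>0$. 1. If $\beta\le 2\ln\tan\left(\frac\pi4+\frac{b_0}2\right)$, then every Riemannian metric $g$ on $K$ conformal to $g_\beta$ satisfies $$l_v(g)\,l_\sigma(g)\le\frac{\arcsin x}{x}\,\mathrm{vol}(g),\qquad x=\frac{e^\beta-1}{e^\beta+1}.$$ Equality is achieved by a metric conformal to $g_\beta$ that is spherical with parameter $b$, where $b\in(0,b_0]$ and $\beta=2\ln\tan\left(\frac\pi4+\frac b2\right)$. 2. If $\beta>2\ln\tan\left(\frac\pi4+\frac{b_0}2\right)$, then the equation $$2\sin\omega=\left(\beta-2\ln\tan\left(\tfrac\pi4+\tfrac\omega2\right)\right)\cos^2\omega+4\omega\cos\omega$$ has exactly one solution $\omega\in[b_0,\pi/2)$, and every Riemannian metric $g$ on $K$ conformal to $g_\beta$ satisfies $$l_v(g)\,l_\sigma(g)\le\frac1{2\cos\omega}\,\mathrm{vol}(g).$$ Equality is achieved by a metric conformal to $g_\beta$ that is flat-spherical with parameters $\omega<b$, where $b=\tan\omega-\omega$. -/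

import Mathlib

noncomputable section

open Set

namespace Klein

/-! ### The Klein bottle `ℂ / ⟨σ, t⟩` -/

/-- The glide reflection `z ↦ conj z + π`, an isometry of the Euclidean plane. -/
def glide : ℂ ≃ᵢ ℂ :=
  Complex.conjLIE.toIsometryEquiv.trans (IsometryEquiv.addRight (Real.pi : ℂ))

/-- The vertical translation `z ↦ z + 2 i β`. -/
def vert (β : ℝ) : ℂ ≃ᵢ ℂ := IsometryEquiv.addRight (2 * Complex.I * (β : ℂ))

/-- The group of isometries of the plane generated by the glide reflection and the translation. -/
def deckGroup (β : ℝ) : Subgroup (ℂ ≃ᵢ ℂ) := Subgroup.closure {glide, vert β}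

/-- Two points of the plane are identified when a deck transformation maps one to the other. -/
def orbitSetoid (β : ℝ) : Setoid ℂ where
  r z w := ∃ τ ∈ deckGroup β, τ z = w
  iseqv :=
    { refl := fun _ => ⟨1, one_mem _, rfl⟩
      symm := by
        rintro z w ⟨τ, hτ, rfl⟩
        exact ⟨τ⁻¹, inv_mem hτ, τ.symm_apply_apply z⟩
      trans := by
        rintro z w x ⟨τ, hτ, rfl⟩ ⟨ρ, hρ, rfl⟩
        exact ⟨ρ * τ, mul_mem hρ hτ, rfl⟩ }

/-- The Klein bottle, with the quotient topology. -/
abbrev Bottle (β : ℝ) : Type := Quotient (orbitSetoid β)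

/-- The quotient map from the plane onto the Klein bottle. -/
def proj (β : ℝ) (z : ℂ) : Bottle β := Quotient.mk (orbitSetoid β) z

/-! ### Riemannian metrics -/

/-- A (continuous) Riemannian metric on the Klein bottle, written on its universal cover `ℂ`: a
continuous field of inner products on the plane that is invariant under the two generators of the
deck group, whose differentials are complex conjugation and the identity. -/
structure RiemMetric (β : ℝ) where
  form : ℂ → LinearMap.BilinForm ℝ ℂ
  symm : ∀ z ξ η, form z ξ η = form z η ξ
  pos : ∀ z ξ, ξ ≠ 0 → 0 < form z ξ ξ
  cont : ∀ ξ η, Continuous fun z => form z ξ η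
  glide_inv : ∀ z ξ η,
    form (glide z) (starRingEnd ℂ ξ) (starRingEnd ℂ η) = form z ξ η
  vert_inv : ∀ z ξ η, form (vert β z) ξ η = form z ξ η

/-- The flat metric `g_β` induced by the Euclidean metric of the plane. -/
def flat (β : ℝ) : RiemMetric β where
  form _ := innerₗ ℂ
  symm _ ξ η := real_inner_comm η ξ
  pos _ ξ hξ := real_inner_self_pos.2 hξ
  cont _ _ := continuous_const
  glide_inv _ ξ η := by
    simp [Complex.inner]
  vert_inv _ _ _ := rfl

variable {β : ℝ}

/-- Two metrics are conformal if they differ by a positive function. -/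
def RiemMetric.Conformal (g h : RiemMetric β) : Prop :=
  ∃ lam : ℂ → ℝ, (∀ z, 0 < lam z) ∧ ∀ z ξ η, g.form z ξ η = lam z * h.form z ξ η

/-- The length of a curve of the Klein bottle that is lifted to `γ : [0, 1] → ℂ`. -/
def RiemMetric.length (g : RiemMetric β) (γ : ℝ → ℂ) : ℝ :=
  ∫ s in (0 : ℝ)..1, Real.sqrt (g.form (γ s) (deriv γ s) (deriv γ s))

/-- The area of the Klein bottle: the integral of `√(det g)` over the fundamental
domain `[0, π) × [-β, β)`. -/
def RiemMetric.vol (g : RiemMetric β) : ℝ :=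
  ∫ z in Ico 0 Real.pi ×ℂ Ico (-β) β,
    Real.sqrt (g.form z 1 1 * g.form z Complex.I Complex.I - g.form z 1 Complex.I ^ 2)

/-! ### Free homotopy classes and their minimal lengths -/

/-- `γ` is piecewise `C¹` on `[0, 1]`. -/
def PiecewiseC1 (γ : ℝ → ℂ) : Prop :=
  ∃ (n : ℕ) (a : ℕ → ℝ), Monotone a ∧ a 0 = 0 ∧ a n = 1 ∧
    ∀ i < n, ContDiffOn ℝ 1 γ (Icc (a i) (a (i + 1)))

/-- Two loops parametrized by `[0, 1]` are freely homotopic, i.e. homotopic through loops. -/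
def FreelyHomotopic {X : Type*} [TopologicalSpace X] (c₀ c₁ : unitInterval → X) : Prop :=
  ∃ H : C(unitInterval × unitInterval, X),
    (∀ s, H (0, s) = c₀ s) ∧ (∀ s, H (1, s) = c₁ s) ∧ ∀ r, H (r, 0) = H (r, 1)

/-- The least length of a piecewise `C¹` loop of the Klein bottle that is freely homotopic to the
loop `c`; each such loop is given by a lift `γ` to the plane. -/
def RiemMetric.minLength (g : RiemMetric β) (c : unitInterval → Bottle β) : ℝ :=
  sInf {L : ℝ | ∃ γ : ℝ → ℂ, PiecewiseC1 γ ∧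
    FreelyHomotopic (fun s : unitInterval => proj β (γ s)) c ∧ L = g.length γ}

/-- The loop covered by the segment from `0` to `t(0) = 2 i β`. -/
def vertLoop (β : ℝ) (s : unitInterval) : Bottle β :=
  proj β (((s : ℝ) : ℂ) * (2 * Complex.I * (β : ℂ)))

/-- The loop covered by the segment from `0` to `σ(0) = π`. -/
def glideLoop (β : ℝ) (s : unitInterval) : Bottle β :=
  proj β (((s : ℝ) : ℂ) * (Real.pi : ℂ))

/-- The loop covered by the segment from `i β` to `tσ(i β) = i β + π`. -/
def glideLoop' (β : ℝ) (s : unitInterval) : Bottle β :=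
  proj β (Complex.I * (β : ℂ) + ((s : ℝ) : ℂ) * (Real.pi : ℂ))

/-- `l_v`: the least length in the class of the vertical translation. -/
def RiemMetric.lv (g : RiemMetric β) : ℝ := g.minLength (vertLoop β)

/-- `l_σ`: the least length of a curve closed by a glide reflection. The glide reflections
`t ^ k σ` form two conjugacy classes in the deck group, those of `σ` and of `tσ`. -/
def RiemMetric.lσ (g : RiemMetric β) : ℝ :=
  min (g.minLength (glideLoop β)) (g.minLength (glideLoop' β))

/-! ### Spherical and flat-spherical metrics -/

/-- An isometry between two Klein bottles, as a `C¹` diffeomorphism of their universal covers that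
descends to a bijection of the quotients and pulls one metric back to the other. -/
def RiemMetric.Isometric {β' : ℝ} (g : RiemMetric β) (h : RiemMetric β') : Prop :=
  ∃ Φ : ℂ ≃ₜ ℂ, ContDiff ℝ 1 Φ ∧ ContDiff ℝ 1 Φ.symm ∧
    (∀ z w, proj β z = proj β w ↔ proj β' (Φ z) = proj β' (Φ w)) ∧
    ∀ z ξ η, g.form z ξ η = h.form (Φ z) (fderiv ℝ Φ z ξ) (fderiv ℝ Φ z η)

/-- The metric is `f(v)² du² + dv²` in the coordinates `z = u + i v`. -/
def RiemMetric.IsWarped (g : RiemMetric β) (f : ℝ → ℝ) : Prop :=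
  ∀ z ξ η, g.form z ξ η = f z.im ^ 2 * (ξ.re * η.re) + ξ.im * η.im

/-- The spherical metric `f(v)² du² + dv²` on the quotient of the `(u, v)`-plane
by `(u, v) ↦ (u + π, -v)` and `(u, v) ↦ (u, v + 4 b)`, where `f` is `2 b`-periodic and equal to
`cos` on `[-b, b]`. -/
def IsSphericalModel (b : ℝ) (h : RiemMetric (2 * b)) : Prop :=
  ∃ f : ℝ → ℝ, Function.Periodic f (2 * b) ∧ (∀ v, |v| ≤ b → f v = Real.cos v) ∧ h.IsWarped f

/-- The flat-spherical metric `f(v)² du² + dv²` on the same quotient, where `f` is `2 b`-periodic,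
equal to `cos` on `[-ω, ω]` and equal to the constant `cos ω` for `ω ≤ |v| ≤ b`. -/
def IsFlatSphericalModel (b ω : ℝ) (h : RiemMetric (2 * b)) : Prop :=
  ∃ f : ℝ → ℝ, Function.Periodic f (2 * b) ∧ (∀ v, |v| ≤ ω → f v = Real.cos v) ∧
    (∀ v, ω ≤ |v| → |v| ≤ b → f v = Real.cos ω) ∧ h.IsWarped f

/-- `g` is isometric to the spherical model with parameter `b`. -/
def RiemMetric.IsSpherical (g : RiemMetric β) (b : ℝ) : Prop :=
  ∃ h : RiemMetric (2 * b), IsSphericalModel b h ∧ g.Isometric h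

/-- `g` is isometric to the flat-spherical model with parameters `b` and `ω`. -/
def RiemMetric.IsFlatSpherical (g : RiemMetric β) (b ω : ℝ) : Prop :=
  ∃ h : RiemMetric (2 * b), IsFlatSphericalModel b ω h ∧ g.Isometric h

end Klein

end

/-!
Let `g = λ² (dx² + dy²)` be conformal to the flat metric. Each vertical line covers a closed curve
in the class of `t`, and each half great circle, carried to the plane by the Mercator projection
centred on one of the two glide axes `y = 0`, `y = β`, covers a curve closed by a glide reflection.
Averaging over the horizontal translations bounds `l_v` and `l_σ` by integrals of the row integrals
of `λ`. Superposing the great circles that reach a given latitude, as in Archimedes' computation of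
the area of a zone, turns the bounds for `l_σ` into `4 arctan (sinh y) l_σ ≤` the integral of the
row integrals up to height `y`, over both axes together. Integrating these bounds against the
decrease of the profile `1 / cosh (min L (dist y (β ℤ)))`, AM-GM and the Cauchy-Schwarz inequality
give `l_v l_σ ≤ C vol`.

That profile is itself the conformal factor of the extremal metric. For it `l_v` is computed by the
arc length along the vertical lines, and `l_σ ≥ π` because a curve closed by a glide reflection,
compared with the round sphere, joins two antipodal points.
-/

noncomputable section

open Real Set MeasureTheory
open scoped unitInterval

namespace Klein

variable {β : ℝ}

/-! ### The deck group and the covering -/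

theorem glide_re (z : ℂ) : (glide z).re = z.re + π := by simp [glide]

theorem glide_im (z : ℂ) : (glide z).im = -z.im := by simp [glide]

theorem vert_re (z : ℂ) : (vert β z).re = z.re := by simp [vert]

theorem vert_im (z : ℂ) : (vert β z).im = z.im + 2 * β := by simp [vert]

theorem glide_mem_deckGroup : glide ∈ deckGroup β := Subgroup.subset_closure (by simp)

theorem vert_mem_deckGroup : vert β ∈ deckGroup β := Subgroup.subset_closure (by simp)

/-- The deck transformation `t ^ k σ ^ n`. Every element of the deck group has this form. -/
def deck (β : ℝ) (n k : ℤ) : ℂ ≃ᵢ ℂ := vert β ^ k * glide ^ n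

theorem deck_mem_deckGroup (n k : ℤ) : deck β n k ∈ deckGroup β :=
  mul_mem (zpow_mem vert_mem_deckGroup k) (zpow_mem glide_mem_deckGroup n)

theorem glide_semiconjBy_vert : SemiconjBy glide (vert β) (vert β)⁻¹ := by
  rw [SemiconjBy, eq_inv_mul_iff_mul_eq]
  ext z
  apply Complex.ext
  · simp only [IsometryEquiv.mul_apply, vert_re, glide_re]
  · simp only [IsometryEquiv.mul_apply, vert_im, glide_im]
    ring

theorem mem_deckGroup_iff {τ : ℂ ≃ᵢ ℂ} : τ ∈ deckGroup β ↔ ∃ n k : ℤ, τ = deck β n k := by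
  refine ⟨fun hτ => ?_, fun ⟨n, k, h⟩ => h ▸ deck_mem_deckGroup n k⟩
  have hglide (k : ℤ) : glide * vert β ^ k = vert β ^ (-k) * glide := by
    rw [zpow_neg, ← inv_zpow, (glide_semiconjBy_vert.zpow_right k).eq]
  have hglide' (k : ℤ) : glide⁻¹ * vert β ^ k = vert β ^ (-k) * glide⁻¹ := by
    rw [inv_mul_eq_iff_eq_mul, ← mul_assoc, hglide, neg_neg, mul_inv_cancel_right]
  induction hτ using Subgroup.closure_induction_left with
  | one => exact ⟨0, 0, by simp [deck]⟩
  | mul_left x hx y _ hy =>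
    obtain ⟨n, k, rfl⟩ := hy
    rcases hx with rfl | rfl
    · exact ⟨1 + n, -k, by rw [deck, deck, ← mul_assoc, hglide, mul_assoc, zpow_one_add]⟩
    · exact ⟨n, 1 + k, by rw [deck, deck, ← mul_assoc, zpow_one_add]⟩
  | inv_mul_cancel x hx y _ hy =>
    obtain ⟨n, k, rfl⟩ := hy
    rcases hx with rfl | rfl
    · exact ⟨-1 + n, -k, by
        rw [deck, deck, ← mul_assoc, hglide', mul_assoc, zpow_add, zpow_neg_one]⟩
    · exact ⟨n, -1 + k, by rw [deck, deck, ← mul_assoc, zpow_add, zpow_neg_one]⟩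

theorem glide_zpow_re (n : ℤ) (z : ℂ) : ((glide ^ n) z).re = z.re + n * π := by
  induction n using Int.induction_on generalizing z with
  | zero => simp
  | succ i ih =>
    rw [zpow_add_one, IsometryEquiv.mul_apply, ih, glide_re]
    push_cast
    ring
  | pred i ih =>
    obtain ⟨w, rfl⟩ := glide.surjective z
    rw [zpow_sub_one, IsometryEquiv.mul_apply, IsometryEquiv.inv_apply_self, ih, glide_re]
    push_cast
    ring

theorem glide_zpow_im (n : ℤ) (z : ℂ) : ((glide ^ n) z).im = (-1) ^ n * z.im := by
  induction n using Int.induction_on generalizing z with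
  | zero => simp
  | succ i ih =>
    rw [zpow_add_one, IsometryEquiv.mul_apply, ih, glide_im, zpow_add_one₀ (by norm_num)]
    ring
  | pred i ih =>
    obtain ⟨w, rfl⟩ := glide.surjective z
    rw [zpow_sub_one, IsometryEquiv.mul_apply, IsometryEquiv.inv_apply_self, ih, glide_im,
      zpow_sub_one₀ (by norm_num)]
    ring

theorem vert_zpow_apply (k : ℤ) (z : ℂ) : (vert β ^ k) z = z + k * (2 * Complex.I * β) := by
  induction k using Int.induction_on generalizing z with
  | zero => simp
  | succ i ih =>
    rw [zpow_add_one, IsometryEquiv.mul_apply, ih, vert, IsometryEquiv.addRight_apply]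
    push_cast
    ring
  | pred i ih =>
    obtain ⟨w, rfl⟩ := (vert β).surjective z
    rw [zpow_sub_one, IsometryEquiv.mul_apply, IsometryEquiv.inv_apply_self, ih, vert,
      IsometryEquiv.addRight_apply]
    push_cast
    ring

theorem deck_re (n k : ℤ) (z : ℂ) : (deck β n k z).re = z.re + n * π := by
  simp [deck, vert_zpow_apply, glide_zpow_re]

theorem deck_im (n k : ℤ) (z : ℂ) : (deck β n k z).im = (-1) ^ n * z.im + 2 * β * k := by
  simp [deck, vert_zpow_apply, glide_zpow_im, mul_comm]

theorem deck_zero_zero : deck β 0 0 = 1 := by simp [deck]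

theorem proj_eq_proj_iff_mem {z w : ℂ} : proj β z = proj β w ↔ ∃ τ ∈ deckGroup β, τ z = w :=
  Quotient.eq

theorem proj_eq_proj_iff {z w : ℂ} : proj β z = proj β w ↔ ∃ n k : ℤ, deck β n k z = w := by
  simp only [proj_eq_proj_iff_mem, mem_deckGroup_iff]
  exact ⟨fun ⟨_, ⟨n, k, rfl⟩, h⟩ => ⟨n, k, h⟩, fun ⟨n, k, h⟩ => ⟨_, ⟨n, k, rfl⟩, h⟩⟩

theorem continuous_proj : Continuous (proj β) := continuous_quotient_mk'

theorem int_eq_zero_of_abs_mul_lt {n : ℤ} {p : ℝ} (h : |n * p| < p) : n = 0 := by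
  have hp : 0 < p := (abs_nonneg _).trans_lt h
  rw [abs_mul, abs_of_pos hp] at h
  have hn : |(n : ℝ)| < 1 := lt_of_mul_lt_mul_right (h.trans_eq (one_mul p).symm) hp.le
  exact Int.abs_lt_one_iff.1 (by exact_mod_cast hn)

theorem deck_eq_one_of_norm_sub_lt {n k : ℤ} {z : ℂ}
    (h : ‖deck β n k z - z‖ < min π (2 * β)) : deck β n k = 1 := by
  obtain ⟨hπ, hβ⟩ := lt_min_iff.1 h
  have hre := (Complex.abs_re_le_norm _).trans_lt hπ
  rw [Complex.sub_re, deck_re, add_sub_cancel_left] at hre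
  obtain rfl := int_eq_zero_of_abs_mul_lt hre
  have him := (Complex.abs_im_le_norm _).trans_lt hβ
  rw [Complex.sub_im, deck_im, zpow_zero, one_mul, add_sub_cancel_left, mul_comm] at him
  rw [int_eq_zero_of_abs_mul_lt him, deck_zero_zero]

theorem isCoveringMap_proj (hβ : 0 < β) : IsCoveringMap (proj β) := by
  let _ : MulAction (deckGroup β) ℂ :=
    { smul := fun τ z => τ.1 z
      one_smul := fun _ => rfl
      mul_smul := fun _ _ _ => rfl }
  have h : IsQuotientCoveringMap (proj β) (deckGroup β) :=
    { isQuotientMap_quotient_mk' with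
      continuous_const_smul := fun τ => τ.1.continuous
      apply_eq_iff_mem_orbit := by
        intro z w
        rw [eq_comm, proj_eq_proj_iff_mem]
        exact ⟨fun ⟨τ, hτ, h⟩ => ⟨⟨τ, hτ⟩, h⟩, fun ⟨τ, h⟩ => ⟨τ.1, τ.2, h⟩⟩
      disjoint := by
        intro e
        have hε : 0 < min π (2 * β) / 2 := half_pos (lt_min pi_pos (by positivity))
        refine ⟨Metric.ball e (min π (2 * β) / 2), Metric.ball_mem_nhds _ hε, ?_⟩
        rintro ⟨τ, hτ⟩ ⟨_, ⟨z, hz, rfl⟩, hw⟩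
        obtain ⟨n, k, rfl⟩ := mem_deckGroup_iff.1 hτ
        refine Subtype.ext (deck_eq_one_of_norm_sub_lt (z := z) ?_)
        rw [← dist_eq_norm]
        exact (dist_triangle_right _ _ e).trans_lt
          ((add_lt_add hw hz).trans_eq (add_halves _)) }
  exact h.isCoveringMap

/-! ### Free homotopy classes -/

theorem FreelyHomotopic.exists_deck_conj (hβ : 0 < β) {γ δ : ℝ → ℂ}
    (hγ : ContinuousOn γ (Icc 0 1)) (hδ : ContinuousOn δ (Icc 0 1)) {τ : ℂ ≃ᵢ ℂ}
    (hτ : τ ∈ deckGroup β) (hδτ : τ (δ 0) = δ 1)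
    (h : FreelyHomotopic (fun s : I => proj β (γ s)) fun s => proj β (δ s)) :
    ∃ ρ ∈ deckGroup β, ∃ z, γ 0 = ρ z ∧ γ 1 = ρ (τ z) := by
  obtain ⟨H, hH₀, hH₁, hloop⟩ := h
  have cov := isCoveringMap_proj hβ
  let F := cov.liftHomotopy H ⟨fun s => γ s, hγ.domRestrict⟩ hH₀
  have hF (p : I × I) : proj β (F p) = H p := congrFun (cov.liftHomotopy_lifts H _ hH₀) p
  have hF₀ (s : I) : F (0, s) = γ s := cov.liftHomotopy_zero H _ hH₀ s
  obtain ⟨ρ, hρ, hρδ⟩ : ∃ ρ ∈ deckGroup β, ρ (δ 0) = F (1, 0) := by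
    rw [← proj_eq_proj_iff_mem, hF, hH₁]
    rfl
  have hproj {θ : ℂ ≃ᵢ ℂ} (hθ : θ ∈ deckGroup β) (z : ℂ) : proj β (θ z) = proj β z :=
    (proj_eq_proj_iff_mem.2 ⟨θ, hθ, rfl⟩).symm
  have hF₁ : (fun s : I => F (1, s)) = fun s : I => ρ (δ s) := by
    refine cov.eq_of_comp_eq (by fun_prop) (ρ.continuous.comp hδ.domRestrict) ?_ 0 hρδ.symm
    funext s
    simp only [Function.comp_apply, hF, hH₁, hproj hρ]
  have hends : (fun r : I => F (r, 1)) = fun r : I => ρ (τ (ρ⁻¹ (F (r, 0)))) := by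
    refine cov.eq_of_comp_eq (by fun_prop) (by fun_prop) ?_ 1 ?_
    · funext r
      simp only [Function.comp_apply, hproj hρ, hproj hτ, hproj (inv_mem hρ), hF, hloop]
    · simp only [congrFun hF₁ 1, congrFun hF₁ 0, IsometryEquiv.inv_apply_self, Icc.coe_zero,
        Icc.coe_one, hδτ]
  refine ⟨ρ, hρ, ρ⁻¹ (γ 0), (ρ.apply_inv_self _).symm, ?_⟩
  simpa only [hF₀, Icc.coe_zero, Icc.coe_one] using congrFun hends 0

theorem FreelyHomotopic.abs_im_sub_im_of_vertLoop (hβ : 0 < β) {γ : ℝ → ℂ}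
    (hγ : ContinuousOn γ (Icc 0 1))
    (h : FreelyHomotopic (fun s : I => proj β (γ s)) (vertLoop β)) :
    |(γ 1).im - (γ 0).im| = 2 * β := by
  obtain ⟨ρ, hρ, z, h₀, h₁⟩ := h.exists_deck_conj (δ := fun s => s * (2 * Complex.I * β)) hβ hγ
    (by fun_prop) vert_mem_deckGroup (by simp [vert])
  obtain ⟨n, k, rfl⟩ := mem_deckGroup_iff.1 hρ
  rw [h₀, h₁, deck_im, deck_im, vert_im, add_sub_add_right_eq_sub, ← mul_sub, add_sub_cancel_left,
    abs_mul, abs_zpow, abs_neg, abs_one, one_zpow, one_mul, abs_of_pos (by positivity)]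

theorem exists_eq_deck_one {ρ τ : ℂ ≃ᵢ ℂ} (hρ : ρ ∈ deckGroup β) (hτ : τ ∈ deckGroup β)
    (hre : ∀ z, (τ z).re = z.re + π) : ∃ k : ℤ, ρ * τ * ρ⁻¹ = deck β 1 k := by
  obtain ⟨n, k, hnk⟩ := mem_deckGroup_iff.1 (mul_mem (mul_mem hρ hτ) (inv_mem hρ))
  obtain ⟨m, l, rfl⟩ := mem_deckGroup_iff.1 hρ
  have h := congrArg Complex.re (congrFun (congrArg DFunLike.coe hnk) (deck β m l 0))
  simp only [IsometryEquiv.mul_apply, IsometryEquiv.inv_apply_self, deck_re, hre] at h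
  have hn : (n : ℝ) = 1 := mul_right_cancel₀ pi_ne_zero (by linarith)
  exact ⟨k, by rw [hnk, Int.cast_eq_one.1 hn]⟩

theorem FreelyHomotopic.exists_deck_one (hβ : 0 < β) {γ δ : ℝ → ℂ}
    (hγ : ContinuousOn γ (Icc 0 1)) (hδ : ContinuousOn δ (Icc 0 1)) {τ : ℂ ≃ᵢ ℂ}
    (hτ : τ ∈ deckGroup β) (hre : ∀ z, (τ z).re = z.re + π) (hδτ : τ (δ 0) = δ 1)
    (h : FreelyHomotopic (fun s : I => proj β (γ s)) fun s => proj β (δ s)) :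
    ∃ k : ℤ, deck β 1 k (γ 0) = γ 1 := by
  obtain ⟨ρ, hρ, z, h₀, h₁⟩ := h.exists_deck_conj hβ hγ hδ hτ hδτ
  obtain ⟨k, hk⟩ := exists_eq_deck_one hρ hτ hre
  exact ⟨k, by simp [← hk, h₀, h₁]⟩

theorem FreelyHomotopic.exists_deck_one_of_glideLoop (hβ : 0 < β) {γ : ℝ → ℂ}
    (hγ : ContinuousOn γ (Icc 0 1))
    (h : FreelyHomotopic (fun s : I => proj β (γ s)) (glideLoop β)) :
    ∃ k : ℤ, deck β 1 k (γ 0) = γ 1 :=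
  h.exists_deck_one (δ := fun s => s * π) hβ hγ (by fun_prop) glide_mem_deckGroup glide_re
    (by simp [glide])

theorem FreelyHomotopic.exists_deck_one_of_glideLoop' (hβ : 0 < β) {γ : ℝ → ℂ}
    (hγ : ContinuousOn γ (Icc 0 1))
    (h : FreelyHomotopic (fun s : I => proj β (γ s)) (glideLoop' β)) :
    ∃ k : ℤ, deck β 1 k (γ 0) = γ 1 :=
  h.exists_deck_one (δ := fun s => Complex.I * β + s * π) hβ hγ (by fun_prop)
    (mul_mem vert_mem_deckGroup glide_mem_deckGroup)
    (fun z => by rw [IsometryEquiv.mul_apply, vert_re, glide_re])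
    (by apply Complex.ext <;> simp [vert, glide]; ring)

/-! ### Lengths of piecewise `C¹` curves -/

theorem PiecewiseC1.of_contDiff {γ : ℝ → ℂ} (h : ContDiff ℝ 1 γ) : PiecewiseC1 γ :=
  ⟨1, fun i => i, Nat.mono_cast, by simp, by simp, fun _ _ => h.contDiffOn⟩

theorem PiecewiseC1.induction {γ : ℝ → ℂ} (hγ : PiecewiseC1 γ) {P : ℝ → Prop} (zero : P 0)
    (step : ∀ a b, 0 ≤ a → a ≤ b → ContDiffOn ℝ 1 γ (Icc a b) → P a → P b) : P 1 := by
  obtain ⟨n, a, hmono, h₀, h₁, hC⟩ := hγ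
  have h : ∀ j ≤ n, P (a j) := by
    intro j
    induction j with
    | zero => exact fun _ => h₀ ▸ zero
    | succ j ih =>
      exact fun hj => step _ _ (h₀ ▸ hmono j.zero_le) (hmono j.le_succ) (hC j hj)
        (ih (j.le_succ.trans hj))
  exact h₁ ▸ h n le_rfl

theorem PiecewiseC1.continuousOn {γ : ℝ → ℂ} (hγ : PiecewiseC1 γ) :
    ContinuousOn γ (Icc 0 1) := by
  refine hγ.induction (P := fun b => ContinuousOn γ (Icc 0 b)) ?_ fun a b ha hab hC h => ?_
  · rw [Icc_self]
    exact continuousOn_singleton _ _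
  · rw [← Icc_union_Icc_eq_Icc ha hab]
    exact h.union_of_isClosed hC.continuousOn isClosed_Icc isClosed_Icc

section Gradient

variable {E : Type*} [NormedAddCommGroup E] [NormedSpace ℝ E] {γ : ℝ → E} {a b : ℝ}
  {φ G : E → ℝ}

theorem intervalIntegrable_mul_norm_deriv (hab : a ≤ b) (hγ : ContDiffOn ℝ 1 γ (Icc a b))
    (hφ : Continuous φ) :
    IntervalIntegrable (fun s => φ (γ s) * ‖deriv γ s‖) volume a b := by
  rcases hab.eq_or_lt with rfl | hab
  · exact IntervalIntegrable.refl
  have hc : ContinuousOn (fun s => φ (γ s) * ‖derivWithin γ (Icc a b) s‖) (Icc a b) :=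
    (hφ.comp_continuousOn hγ.continuousOn).mul
      (hγ.continuousOn_derivWithin (uniqueDiffOn_Icc hab) le_rfl).norm
  rw [intervalIntegrable_iff_integrableOn_Ioo_of_le hab.le]
  refine (hc.integrableOn_Icc.mono_set Ioo_subset_Icc_self).congr_fun (fun s hs => ?_)
    measurableSet_Ioo
  simp only [derivWithin_of_mem_nhds (Icc_mem_nhds hs.1 hs.2)]

theorem sub_le_integral_mul_norm_deriv (hab : a ≤ b) (hγ : ContDiffOn ℝ 1 γ (Icc a b))
    (hφ : Continuous φ) (hG : Differentiable ℝ G) (hle : ∀ z ξ, fderiv ℝ G z ξ ≤ φ z * ‖ξ‖) :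
    G (γ b) - G (γ a) ≤ ∫ s in a..b, φ (γ s) * ‖deriv γ s‖ := by
  refine intervalIntegral.sub_le_integral_of_hasDeriv_right_of_le hab
    (hG.continuous.comp_continuousOn hγ.continuousOn) (g := G ∘ γ)
    (g' := fun s => fderiv ℝ G (γ s) (deriv γ s)) (fun s hs => ?_) ?_ fun s _ => hle _ _
  · have hd : DifferentiableAt ℝ γ s :=
      (hγ.differentiableOn one_ne_zero).differentiableAt (Icc_mem_nhds hs.1 hs.2)
    exact ((hG (γ s)).hasFDerivAt.comp_hasDerivAt s hd.hasDerivAt).hasDerivWithinAt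
  · rw [← intervalIntegrable_iff_integrableOn_Icc_of_le hab]
    exact intervalIntegrable_mul_norm_deriv hab hγ hφ

end Gradient

theorem PiecewiseC1.sub_le_integral {γ : ℝ → ℂ} (hγ : PiecewiseC1 γ) {φ G : ℂ → ℝ}
    (hφ : Continuous φ) (hG : Differentiable ℝ G) (hle : ∀ z ξ, fderiv ℝ G z ξ ≤ φ z * ‖ξ‖) :
    G (γ 1) - G (γ 0) ≤ ∫ s in 0..1, φ (γ s) * ‖deriv γ s‖ := by
  refine (hγ.induction (P := fun b =>
    IntervalIntegrable (fun s => φ (γ s) * ‖deriv γ s‖) volume 0 b ∧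
      G (γ b) - G (γ 0) ≤ ∫ s in 0..b, φ (γ s) * ‖deriv γ s‖) (by simp)
    fun a b _ hab hC ⟨hint, ih⟩ => ?_).2
  have hint' := intervalIntegrable_mul_norm_deriv hab hC hφ
  refine ⟨hint.trans hint', ?_⟩
  rw [← intervalIntegral.integral_add_adjacent_intervals hint hint']
  linarith [sub_le_integral_mul_norm_deriv hab hC hφ hG hle, ih]

/-! ### Conformal metrics -/

/-- The length of the unit vectors at `z` for a metric conformal to the flat one, whose conformal
factor is therefore `g.factor ^ 2`. For other metrics it is the length of the vector `1` only. -/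
def RiemMetric.factor (g : RiemMetric β) (z : ℂ) : ℝ := √(g.form z 1 1)

theorem RiemMetric.factor_pos (g : RiemMetric β) (z : ℂ) : 0 < g.factor z :=
  sqrt_pos.2 (g.pos z 1 one_ne_zero)

@[fun_prop]
theorem RiemMetric.continuous_factor (g : RiemMetric β) : Continuous g.factor :=
  (g.cont 1 1).sqrt

theorem RiemMetric.factor_glide (g : RiemMetric β) (z : ℂ) :
    g.factor (glide z) = g.factor z := by
  have h := g.glide_inv z 1 1
  rw [map_one] at h
  rw [factor, factor, h]

theorem RiemMetric.factor_vert (g : RiemMetric β) (z : ℂ) :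
    g.factor (vert β z) = g.factor z := by
  rw [factor, factor, g.vert_inv]

theorem RiemMetric.Conformal.form_eq {g : RiemMetric β} (hg : g.Conformal (flat β)) (z ξ η : ℂ) :
    g.form z ξ η = g.factor z ^ 2 * inner ℝ ξ η := by
  obtain ⟨lam, -, h⟩ := hg
  have hform (ξ η : ℂ) : g.form z ξ η = lam z * inner ℝ ξ η := h z ξ η
  rw [factor, sq_sqrt (g.pos z 1 one_ne_zero).le, hform, hform]
  simp

theorem RiemMetric.Conformal.length_eq {g : RiemMetric β} (hg : g.Conformal (flat β))
    (γ : ℝ → ℂ) : g.length γ = ∫ s in 0..1, g.factor (γ s) * ‖deriv γ s‖ := by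
  simp only [length, hg.form_eq, real_inner_self_eq_norm_sq, ← mul_pow]
  exact intervalIntegral.integral_congr fun s _ =>
    sqrt_sq (mul_nonneg (g.factor_pos _).le (norm_nonneg _))

theorem RiemMetric.Conformal.vol_eq {g : RiemMetric β} (hg : g.Conformal (flat β)) :
    g.vol = ∫ z in Ico 0 π ×ℂ Ico (-β) β, g.factor z ^ 2 := by
  have hdet (z : ℂ) : g.form z 1 1 * g.form z Complex.I Complex.I - g.form z 1 Complex.I ^ 2 =
      (g.factor z ^ 2) ^ 2 := by
    simp [hg.form_eq, Complex.inner]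
    ring
  simp only [vol, hdet, sqrt_sq (sq_nonneg _)]

theorem RiemMetric.length_nonneg (g : RiemMetric β) (γ : ℝ → ℂ) : 0 ≤ g.length γ :=
  intervalIntegral.integral_nonneg zero_le_one fun _ _ => sqrt_nonneg _

theorem RiemMetric.minLength_nonneg (g : RiemMetric β) (c : I → Bottle β) :
    0 ≤ g.minLength c :=
  sInf_nonneg (by rintro _ ⟨γ, -, -, rfl⟩; exact g.length_nonneg γ)

theorem freelyHomotopic_of_deck {γ δ : ℝ → ℂ} (hγ : Continuous γ) (hδ : Continuous δ)
    {τ : ℂ ≃ᵢ ℂ} (hτ : τ ∈ deckGroup β) (hγτ : τ (γ 0) = γ 1) (hδτ : τ (δ 0) = δ 1) :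
    FreelyHomotopic (fun s : I => proj β (γ s)) fun s => proj β (δ s) := by
  refine ⟨⟨fun p => proj β (AffineMap.lineMap (γ p.2) (δ p.2) (p.1 : ℝ)),
    continuous_proj.comp ?_⟩, fun s => by simp, fun s => by simp, fun r => ?_⟩
  · simp only [AffineMap.lineMap_apply_module]
    fun_prop
  · have h := τ.toRealAffineIsometryEquiv.toAffineEquiv.apply_lineMap (γ 0) (δ 0) r
    simp only [AffineIsometryEquiv.coe_toAffineEquiv,
      IsometryEquiv.coeFn_toRealAffineIsometryEquiv, hγτ, hδτ] at h
    exact proj_eq_proj_iff_mem.2 ⟨τ, hτ, h⟩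

theorem RiemMetric.minLength_le_length (g : RiemMetric β) {γ δ : ℝ → ℂ} (hγ : ContDiff ℝ 1 γ)
    (hδ : Continuous δ) {τ : ℂ ≃ᵢ ℂ} (hτ : τ ∈ deckGroup β) (hγτ : τ (γ 0) = γ 1)
    (hδτ : τ (δ 0) = δ 1) : g.minLength (fun s => proj β (δ s)) ≤ g.length γ :=
  csInf_le ⟨0, by rintro _ ⟨γ, -, -, rfl⟩; exact g.length_nonneg γ⟩
    ⟨γ, .of_contDiff hγ, freelyHomotopic_of_deck hγ.continuous hδ hτ hγτ hδτ, rfl⟩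

theorem RiemMetric.le_minLength (g : RiemMetric β) {δ : ℝ → ℂ} (hδ : ContDiff ℝ 1 δ)
    {τ : ℂ ≃ᵢ ℂ} (hτ : τ ∈ deckGroup β) (hδτ : τ (δ 0) = δ 1) {B : ℝ}
    (h : ∀ γ : ℝ → ℂ, PiecewiseC1 γ → FreelyHomotopic (fun s : I => proj β (γ s))
      (fun s => proj β (δ s)) → B ≤ g.length γ) :
    B ≤ g.minLength fun s => proj β (δ s) := by
  refine le_csInf ⟨_, δ, .of_contDiff hδ,
    freelyHomotopic_of_deck hδ.continuous hδ.continuous hτ hδτ hδτ, rfl⟩ ?_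
  rintro _ ⟨γ, hγ, hγδ, rfl⟩
  exact h γ hγ hγδ

/-! ### Test curves -/

/-- The function `factor` in the coordinates `z = x + i y`. -/
def RiemMetric.coordFactor (g : RiemMetric β) (x y : ℝ) : ℝ := g.factor (x + y * Complex.I)

theorem RiemMetric.coordFactor_pos (g : RiemMetric β) (x y : ℝ) : 0 < g.coordFactor x y :=
  g.factor_pos _

@[fun_prop]
theorem RiemMetric.continuous_coordFactor (g : RiemMetric β) {X : Type*} [TopologicalSpace X]
    {u v : X → ℝ} (hu : Continuous u) (hv : Continuous v) :
    Continuous fun p => g.coordFactor (u p) (v p) := by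
  unfold coordFactor
  fun_prop

theorem RiemMetric.coordFactor_add_pi (g : RiemMetric β) (x y : ℝ) :
    g.coordFactor (x + π) y = g.coordFactor x (-y) := by
  rw [coordFactor, coordFactor, ← g.factor_glide (x + (-y : ℝ) * Complex.I)]
  congr 1
  apply Complex.ext <;> simp [glide_re, glide_im]

theorem RiemMetric.coordFactor_add_two_pi (g : RiemMetric β) (x y : ℝ) :
    g.coordFactor (x + 2 * π) y = g.coordFactor x y := by
  rw [two_mul, ← add_assoc, coordFactor_add_pi, coordFactor_add_pi, neg_neg]

theorem RiemMetric.coordFactor_add_two_mul (g : RiemMetric β) (x y : ℝ) :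
    g.coordFactor x (y + 2 * β) = g.coordFactor x y := by
  rw [coordFactor, coordFactor, ← g.factor_vert (x + y * Complex.I)]
  congr 1
  apply Complex.ext <;> simp [vert_re, vert_im]

theorem hasDerivAt_ofReal_add_ofReal_mul_I {u v : ℝ → ℝ} {u' v' s : ℝ} (hu : HasDerivAt u u' s)
    (hv : HasDerivAt v v' s) :
    HasDerivAt (fun s => (u s : ℂ) + v s * Complex.I) (u' + v' * Complex.I) s :=
  hu.ofReal_comp.add (hv.ofReal_comp.mul_const Complex.I)

theorem contDiff_ofReal_add_ofReal_mul_I {u v : ℝ → ℝ} {n : WithTop ℕ∞} (hu : ContDiff ℝ n u)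
    (hv : ContDiff ℝ n v) : ContDiff ℝ n fun s => (u s : ℂ) + v s * Complex.I :=
  (Complex.ofRealCLM.contDiff.comp hu).add
    ((Complex.ofRealCLM.contDiff.comp hv).mul contDiff_const)

theorem RiemMetric.Conformal.lv_le {g : RiemMetric β} (hg : g.Conformal (flat β)) (hβ : 0 < β)
    (x : ℝ) : g.lv ≤ ∫ y in -β..β, g.coordFactor x y := by
  let γ (s : ℝ) : ℂ := x + (-β + 2 * β * s : ℝ) * Complex.I
  have hγ' (s : ℝ) : HasDerivAt γ ((0 : ℝ) + (2 * β : ℝ) * Complex.I) s :=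
    hasDerivAt_ofReal_add_ofReal_mul_I (hasDerivAt_const s x)
      ((hasDerivAt_const_mul (2 * β)).const_add (-β))
  have hγ : ContDiff ℝ 1 γ := contDiff_ofReal_add_ofReal_mul_I contDiff_const (by fun_prop)
  have hends : vert β (γ 0) = γ 1 := by apply Complex.ext <;> simp [γ, vert_re, vert_im]
  have hlength : g.length γ = ∫ y in -β..β, g.coordFactor x y := by
    have h := intervalIntegral.mul_integral_comp_add_mul (a := 0) (b := 1)
      (f := fun y => g.coordFactor x y) (2 * β) (-β)
    rw [show -β + 2 * β * 0 = -β by ring, show -β + 2 * β * 1 = β by ring] at h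
    rw [hg.length_eq, ← h, ← intervalIntegral.integral_const_mul]
    refine intervalIntegral.integral_congr fun s _ => ?_
    have hnorm : ‖deriv γ s‖ = 2 * β := by simp [(hγ' s).deriv, abs_of_pos hβ]
    rw [hnorm, mul_comm, coordFactor]
  exact hlength ▸ g.minLength_le_length hγ (δ := fun s => s * (2 * Complex.I * β)) (by fun_prop)
    vert_mem_deckGroup hends (by simp [vert])

/-- The Mercator image of a half great circle of the unit sphere, where the parallel `Im z = c` is
the equator and `T` is the tangent of the angle between the two circles. -/
def halfGreatCircle (x c T s : ℝ) : ℂ :=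
  (x + π * s : ℝ) + (c + arsinh (T * sin (π * s)) : ℝ) * Complex.I

theorem hasDerivAt_halfGreatCircle (x c T s : ℝ) :
    HasDerivAt (halfGreatCircle x c T)
      ((π : ℝ) + ((√(1 + (T * sin (π * s)) ^ 2))⁻¹ * (T * (cos (π * s) * π)) : ℝ) * Complex.I)
      s := by
  have hθ : HasDerivAt (fun s : ℝ => π * s) π s := hasDerivAt_const_mul π
  exact hasDerivAt_ofReal_add_ofReal_mul_I (hθ.const_add x)
    (((hasDerivAt_arsinh _).comp s (hθ.sin.const_mul T)).const_add c)

theorem norm_deriv_halfGreatCircle (x c T s : ℝ) :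
    ‖deriv (halfGreatCircle x c T) s‖ =
      π * (√(1 + T ^ 2) / √(1 + (T * sin (π * s)) ^ 2)) := by
  have hp : 0 < 1 + (T * sin (π * s)) ^ 2 := by positivity
  rw [(hasDerivAt_halfGreatCircle x c T s).deriv, Complex.norm_add_mul_I,
    ← sqrt_div' _ hp.le, sqrt_eq_iff_eq_sq (by positivity) (by positivity), mul_pow π,
    mul_pow (√_)⁻¹, inv_pow, sq_sqrt hp.le, sq_sqrt (by positivity)]
  field_simp
  linear_combination T ^ 2 * sin_sq_add_cos_sq (π * s)

theorem contDiff_halfGreatCircle (x c T : ℝ) : ContDiff ℝ 1 (halfGreatCircle x c T) :=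
  contDiff_ofReal_add_ofReal_mul_I (by fun_prop)
    (contDiff_const.add (contDiff_arsinh.comp (by fun_prop)))

theorem RiemMetric.Conformal.length_halfGreatCircle {g : RiemMetric β}
    (hg : g.Conformal (flat β)) (x c T : ℝ) :
    g.length (halfGreatCircle x c T) =
      ∫ θ in 0..π, g.coordFactor (x + θ) (c + arsinh (T * sin θ)) *
        (√(1 + T ^ 2) / √(1 + (T * sin θ) ^ 2)) := by
  have h := intervalIntegral.mul_integral_comp_mul_left (a := 0) (b := 1)
    (f := fun θ => g.coordFactor (x + θ) (c + arsinh (T * sin θ)) *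
      (√(1 + T ^ 2) / √(1 + (T * sin θ) ^ 2))) π
  rw [mul_zero, mul_one] at h
  rw [hg.length_eq, ← h, ← intervalIntegral.integral_const_mul]
  refine intervalIntegral.integral_congr fun s _ => ?_
  simp only [norm_deriv_halfGreatCircle, halfGreatCircle, coordFactor]
  ring

theorem RiemMetric.Conformal.lσ_le {g : RiemMetric β} (hg : g.Conformal (flat β)) {c : ℝ}
    (hc : c = 0 ∨ c = β) (x T : ℝ) :
    g.lσ ≤ ∫ θ in 0..π, g.coordFactor (x + θ) (c + arsinh (T * sin θ)) *
      (√(1 + T ^ 2) / √(1 + (T * sin θ) ^ 2)) := by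
  rw [← hg.length_halfGreatCircle]
  rcases hc with rfl | rfl
  · refine min_le_of_left_le (g.minLength_le_length (contDiff_halfGreatCircle x 0 T)
      (δ := fun s => s * π) (by fun_prop) glide_mem_deckGroup ?_ (by simp [glide]))
    apply Complex.ext <;> simp [halfGreatCircle, glide_re, glide_im]
  · refine min_le_of_right_le (g.minLength_le_length (contDiff_halfGreatCircle x c T)
      (δ := fun s => Complex.I * c + s * π) (by fun_prop) (deck_mem_deckGroup 1 1) ?_ ?_)
    · apply Complex.ext <;> simp [halfGreatCircle, deck_re, deck_im]
      ring
    · apply Complex.ext <;> simp [deck_re, deck_im]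
      ring

/-! ### Averages over circles -/

theorem setLIntegral_Ioo_ofReal_deriv {F F' : ℝ → ℝ} {a b : ℝ} (hab : a ≤ b)
    (hc : ContinuousOn F (Icc a b)) (hd : ∀ x ∈ Ioo a b, HasDerivAt F (F' x) x)
    (hpos : ∀ x ∈ Ioo a b, 0 ≤ F' x) :
    ∫⁻ x in Ioo a b, ENNReal.ofReal (F' x) = ENNReal.ofReal (F b - F a) := by
  have hi := intervalIntegral.integrableOn_deriv_of_nonneg hc hd hpos
  rw [← intervalIntegral.integral_eq_sub_of_hasDerivAt_of_le hab hc hd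
      ((intervalIntegrable_iff_integrableOn_Ioc_of_le hab).2 hi),
    intervalIntegral.integral_of_le hab, integral_Ioc_eq_integral_Ioo,
    ofReal_integral_eq_lintegral_ofReal (hi.mono_set Ioo_subset_Ioc_self)]
  exact (ae_restrict_iff' measurableSet_Ioo).2 (.of_forall hpos)

theorem ofReal_intervalIntegral_eq_setLIntegral {f : ℝ → ℝ} (hf : Continuous f)
    (hf₀ : ∀ x, 0 ≤ f x) {a b : ℝ} (hab : a ≤ b) :
    ENNReal.ofReal (∫ x in a..b, f x) = ∫⁻ x in Ioo a b, ENNReal.ofReal (f x) := by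
  rw [intervalIntegral.integral_of_le hab, integral_Ioc_eq_integral_Ioo]
  exact ofReal_integral_eq_lintegral_ofReal
    (hf.continuousOn.integrableOn_Icc.mono_set Ioo_subset_Icc_self) (.of_forall hf₀)

/-- The density at distance `√q` from the centre of the orthogonal projection to the plane of the
area of the sphere of radius `ρ`, up to the factor `2 * π * ρ`. It vanishes outside the disk because
the square root of a negative number and the inverse of `0` are `0`. -/
def sphereDensity (ρ q : ℝ) : ℝ := (π * √(ρ ^ 2 - q))⁻¹

theorem sphereDensity_nonneg (ρ q : ℝ) : 0 ≤ sphereDensity ρ q := by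
  unfold sphereDensity
  positivity

theorem sphereDensity_eq_zero {ρ q : ℝ} (h : ρ ^ 2 ≤ q) : sphereDensity ρ q = 0 := by
  rw [sphereDensity, sqrt_eq_zero_of_nonpos (sub_nonpos.2 h), mul_zero, inv_zero]

@[fun_prop]
theorem measurable_sphereDensity (ρ : ℝ) : Measurable (sphereDensity ρ) := by
  unfold sphereDensity
  fun_prop

theorem hasDerivAt_arcsin_div {r x : ℝ} (hx : x ∈ Ioo (-r) r) :
    HasDerivAt (fun x => arcsin (x / r)) (√(r ^ 2 - x ^ 2))⁻¹ x := by
  have hr : 0 < r := by linarith [hx.1, hx.2]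
  have hlt : x / r < 1 := (div_lt_one hr).2 hx.2
  have hgt : -1 < x / r := by
    rw [lt_div_iff₀ hr]
    linarith [hx.1]
  refine ((hasDerivAt_arcsin hgt.ne' hlt.ne).comp x ((hasDerivAt_id x).div_const r)).congr_deriv ?_
  rw [show r ^ 2 - x ^ 2 = r ^ 2 * (1 - (x / r) ^ 2) by field_simp, sqrt_mul (sq_nonneg _),
    sqrt_sq hr.le]
  field_simp

theorem lintegral_sphereDensity_line {ρ z : ℝ} (hz : z ^ 2 < ρ ^ 2) :
    ∫⁻ x : ℝ, ENNReal.ofReal (sphereDensity ρ (x ^ 2 + z ^ 2)) = 1 := by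
  set r := √(ρ ^ 2 - z ^ 2)
  have hr : 0 < r := sqrt_pos.2 (sub_pos.2 hz)
  have hr2 : r ^ 2 = ρ ^ 2 - z ^ 2 := sq_sqrt (sub_pos.2 hz).le
  have hdensity (x : ℝ) : sphereDensity ρ (x ^ 2 + z ^ 2) = π⁻¹ * (√(r ^ 2 - x ^ 2))⁻¹ := by
    rw [sphereDensity, mul_inv, hr2, sub_sub, add_comm]
  rw [← setLIntegral_eq_of_support_subset (s := Ioo (-r) r)]
  · simp only [hdensity]
    rw [setLIntegral_Ioo_ofReal_deriv (F := fun x => π⁻¹ * arcsin (x / r)) (by linarith)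
      (by fun_prop) (fun x hx => (hasDerivAt_arcsin_div hx).const_mul _) fun x _ => by positivity]
    rw [neg_div, div_self hr.ne', arcsin_neg, arcsin_one, ENNReal.ofReal_eq_one]
    field_simp
    norm_num
  · intro x hx
    by_contra h
    refine hx ?_
    have hrx : r ^ 2 ≤ x ^ 2 := by
      by_contra! hlt
      exact h (abs_lt.1 (abs_lt_of_sq_lt_sq hlt hr.le))
    have h0 : sphereDensity ρ (x ^ 2 + z ^ 2) = 0 := sphereDensity_eq_zero (by linarith)
    simp only [h0, ENNReal.ofReal_zero]

theorem lintegral_sphereDensity_radial {ρ : ℝ} (hρ : 0 < ρ) :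
    ∫⁻ T in Ioo 0 ρ, ENNReal.ofReal (T * sphereDensity ρ (T ^ 2) / √(1 + T ^ 2)) =
      ENNReal.ofReal (arctan ρ / π) := by
  have hderiv : ∀ T ∈ Ioo 0 ρ, HasDerivAt
      (fun T => -(π⁻¹ * arcsin (√(ρ ^ 2 - T ^ 2) / √(1 + ρ ^ 2))))
      (T * sphereDensity ρ (T ^ 2) / √(1 + T ^ 2)) T := by
    intro T hT
    have hpos : 0 < ρ ^ 2 - T ^ 2 := by nlinarith [hT.1, hT.2]
    have hsqrt := (((hasDerivAt_pow 2 T).const_sub (ρ ^ 2)).sqrt hpos.ne')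
    have hmem : √(ρ ^ 2 - T ^ 2) ∈ Ioo (-√(1 + ρ ^ 2)) √(1 + ρ ^ 2) :=
      ⟨by linarith [sqrt_pos.2 hpos, sqrt_nonneg (1 + ρ ^ 2)],
        sqrt_lt_sqrt hpos.le (by nlinarith [sq_nonneg T])⟩
    refine ((((hasDerivAt_arcsin_div hmem).comp T hsqrt).const_mul π⁻¹).neg).congr_deriv ?_
    rw [sq_sqrt hpos.le, sq_sqrt (by positivity), show 1 + ρ ^ 2 - (ρ ^ 2 - T ^ 2) = 1 + T ^ 2 by
      ring, sphereDensity]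
    field_simp
    ring
  rw [setLIntegral_Ioo_ofReal_deriv hρ.le (by fun_prop) hderiv fun T hT =>
    div_nonneg (mul_nonneg hT.1.le (sphereDensity_nonneg _ _)) (sqrt_nonneg _)]
  rw [arctan_eq_arcsin]
  simp [hρ.le, sqrt_sq, div_eq_inv_mul]

/-- The measure `dz` on `(-ρ, ρ)` is a superposition of the pushforwards of the measures `dθ` under
`θ ↦ T * sin θ`, because it is the projection of the uniform measure on a sphere. -/
theorem lintegral_Ioo_eq_lintegral_lintegral_sin {f : ℝ → ENNReal} (hf : Measurable f) {ρ : ℝ}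
    (hρ : 0 < ρ) :
    ∫⁻ z in Ioo (-ρ) ρ, f z =
      ∫⁻ T in Ioi 0, ENNReal.ofReal (T * sphereDensity ρ (T ^ 2)) *
        ∫⁻ θ in Ioo (-π) π, f (T * sin θ) := by
  trans ∫⁻ p : ℝ × ℝ, f p.2 * ENNReal.ofReal (sphereDensity ρ (p.1 ^ 2 + p.2 ^ 2))
  · rw [Measure.volume_eq_prod, lintegral_prod_symm _ (by fun_prop),
      ← lintegral_indicator measurableSet_Ioo]
    refine lintegral_congr fun z => ?_
    dsimp only
    rw [lintegral_const_mul _ (by fun_prop)]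
    by_cases hz : z ^ 2 < ρ ^ 2
    · have hmem : z ∈ Ioo (-ρ) ρ := abs_lt.1 (abs_lt_of_sq_lt_sq hz hρ.le)
      rw [indicator_of_mem hmem, lintegral_sphereDensity_line hz, mul_one]
    · have h0 (x : ℝ) : sphereDensity ρ (x ^ 2 + z ^ 2) = 0 :=
        sphereDensity_eq_zero (by linarith [sq_nonneg x])
      rw [indicator_of_notMem fun h => hz (sq_lt_sq' h.1 h.2)]
      simp [h0]
  · rw [← lintegral_comp_polarCoord_symm, polarCoord_target, Measure.volume_eq_prod,
      ← Measure.prod_restrict]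
    have hpolar (p : ℝ × ℝ) : (p.1 * cos p.2) ^ 2 + (p.1 * sin p.2) ^ 2 = p.1 ^ 2 := by
      linear_combination p.1 ^ 2 * sin_sq_add_cos_sq p.2
    simp only [polarCoord_symm_apply, hpolar, smul_eq_mul]
    rw [lintegral_prod _ (by fun_prop)]
    refine setLIntegral_congr_fun measurableSet_Ioi fun T hT => ?_
    simp only
    rw [← lintegral_const_mul _ (by fun_prop), ENNReal.ofReal_mul (mem_Ioi.1 hT).le]
    refine lintegral_congr fun θ => ?_
    ring

theorem le_integral_of_le_circle {K : ℝ → ℝ} (hK : Continuous K) (hK₀ : ∀ z, 0 ≤ K z)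
    {C : ℝ} (hC : 0 ≤ C) (h : ∀ T, C / √(1 + T ^ 2) ≤ ∫ θ in -π..π, K (T * sin θ)) {ρ : ℝ}
    (hρ : 0 < ρ) :
    C * (arctan ρ / π) ≤ ∫ z in -ρ..ρ, K z := by
  rw [← ENNReal.ofReal_le_ofReal_iff
      (intervalIntegral.integral_nonneg (by linarith) fun z _ => hK₀ z),
    ofReal_intervalIntegral_eq_setLIntegral hK hK₀ (by linarith),
    lintegral_Ioo_eq_lintegral_lintegral_sin (by fun_prop) hρ, ENNReal.ofReal_mul hC,
    ← lintegral_sphereDensity_radial hρ, ← lintegral_const_mul' _ _ ENNReal.ofReal_ne_top]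
  refine (setLIntegral_mono' measurableSet_Ioo fun T hT => ?_).trans
    (lintegral_mono_set Ioo_subset_Ioi_self)
  have hweight : 0 ≤ T * sphereDensity ρ (T ^ 2) :=
    mul_nonneg hT.1.le (sphereDensity_nonneg _ _)
  rw [← ofReal_intervalIntegral_eq_setLIntegral (f := fun θ => K (T * sin θ)) (by fun_prop)
      (fun _ => hK₀ _) (by linarith [pi_pos]), ← ENNReal.ofReal_mul hC,
    ← ENNReal.ofReal_mul hweight, mul_div_left_comm]
  exact ENNReal.ofReal_le_ofReal (mul_le_mul_of_nonneg_left (h T) hweight)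

/-! ### Comparison of weighted integrals -/

theorem integral_mul_le_integral_mul_of_integral_le {a b w w' : ℝ → ℝ} {L : ℝ} (hL : 0 ≤ L)
    (ha : Continuous a) (hb : Continuous b) (hw : ∀ y, HasDerivAt w (w' y) y)
    (hw' : Continuous w') (hw'₀ : ∀ y ∈ Icc 0 L, w' y ≤ 0) (hwL : 0 ≤ w L)
    (hab : ∀ y ∈ Icc 0 L, ∫ x in 0..y, a x ≤ ∫ x in 0..y, b x) :
    ∫ y in 0..L, a y * w y ≤ ∫ y in 0..L, b y * w y := by
  have hparts {f : ℝ → ℝ} (hf : Continuous f) : ∫ y in 0..L, f y * w y =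
      (∫ x in 0..L, f x) * w L + ∫ y in 0..L, (∫ x in 0..y, f x) * -w' y := by
    have h := intervalIntegral.integral_mul_deriv_eq_deriv_mul (fun y _ => hw y)
      (fun y _ => (hf.integral_hasStrictDerivAt 0 y).hasDerivAt) (hw'.intervalIntegrable 0 L)
      (hf.intervalIntegrable _ _)
    simp only [mul_comm (f _), mul_comm _ (-w' _), neg_mul, intervalIntegral.integral_neg, h]
    simp only [intervalIntegral.integral_same]
    ring
  rw [hparts ha, hparts hb]
  have hprim {f : ℝ → ℝ} (hf : Continuous f) : Continuous fun y => ∫ x in 0..y, f x :=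
    intervalIntegral.continuous_primitive (fun _ _ => hf.intervalIntegrable _ _) 0
  refine add_le_add (mul_le_mul_of_nonneg_right (hab L ⟨hL, le_rfl⟩) hwL)
    (intervalIntegral.integral_mono_on hL (((hprim ha).mul hw'.neg).intervalIntegrable _ _)
      (((hprim hb).mul hw'.neg).intervalIntegrable _ _) fun y hy => ?_)
  exact mul_le_mul_of_nonneg_right (hab y hy) (neg_nonneg.2 (hw'₀ y hy))

/-! ### The extremal profile -/

theorem continuous_one_div_cosh : Continuous fun y => 1 / cosh y :=
  continuous_const.div continuous_cosh fun y => (cosh_pos y).ne'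

theorem hasDerivAt_arctan_sinh (y : ℝ) :
    HasDerivAt (fun y => arctan (sinh y)) (1 / cosh y) y := by
  refine (hasDerivAt_sinh y).arctan.congr_deriv ?_
  have := (cosh_pos y).ne'
  rw [add_comm, ← cosh_sq]
  field_simp

theorem hasDerivAt_tanh (y : ℝ) : HasDerivAt tanh ((1 / cosh y) ^ 2) y := by
  rw [funext tanh_eq_sinh_div_cosh]
  refine ((hasDerivAt_sinh y).div (hasDerivAt_cosh y) (cosh_pos y).ne').congr_deriv ?_
  rw [div_pow, one_pow, ← cosh_sq_sub_sinh_sq y, sq, sq (sinh y)]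

theorem integral_one_div_cosh (a b : ℝ) :
    ∫ y in a..b, 1 / cosh y = arctan (sinh b) - arctan (sinh a) :=
  intervalIntegral.integral_eq_sub_of_hasDerivAt (fun y _ => hasDerivAt_arctan_sinh y)
    (continuous_one_div_cosh.intervalIntegrable a b)

theorem integral_one_div_cosh_sq (a b : ℝ) :
    ∫ y in a..b, (1 / cosh y) ^ 2 = tanh b - tanh a :=
  intervalIntegral.integral_eq_sub_of_hasDerivAt (fun y _ => hasDerivAt_tanh y)
    ((continuous_one_div_cosh.pow 2).intervalIntegrable a b)

/-- The extremal function of the height `y`: the conformal factor `1 / cosh` of the round sphere in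
Mercator coordinates, repeated with period `β` and kept constant at distance more than `L` from
the multiples of `β`. -/
def profile (β L y : ℝ) : ℝ := 1 / cosh (min L ‖(y : AddCircle β)‖)

variable {L : ℝ}

@[fun_prop]
theorem continuous_profile : Continuous (profile β L) :=
  continuous_one_div_cosh.comp
    (continuous_const.min (continuous_norm.comp (AddCircle.continuous_mk' β)))

theorem profile_pos (y : ℝ) : 0 < profile β L y := one_div_pos.2 (cosh_pos _)

theorem profile_periodic : Function.Periodic (profile β L) β := fun y => by
  rw [profile, profile, AddCircle.coe_add_period]

theorem profile_neg (y : ℝ) : profile β L (-y) = profile β L y := by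
  rw [profile, profile, AddCircle.coe_neg, norm_neg]

theorem profile_of_abs_le_half (hβ : 0 < β) {y : ℝ} (hy : |y| ≤ β / 2) :
    profile β L y = 1 / cosh (min L |y|) := by
  rw [profile, (AddCircle.norm_coe_eq_abs_iff β hβ.ne').2 (by rwa [abs_of_pos hβ])]

theorem profile_of_abs_le (hβ : 0 < β) (hL : L ≤ β / 2) {y : ℝ} (hy : |y| ≤ L) :
    profile β L y = 1 / cosh y := by
  rw [profile_of_abs_le_half hβ (hy.trans hL), min_eq_right hy, cosh_abs]

theorem profile_of_le_abs (hβ : 0 < β) {y : ℝ} (hy : L ≤ |y|) (hy' : |y| ≤ β / 2) :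
    profile β L y = 1 / cosh L := by
  rw [profile_of_abs_le_half hβ hy', min_eq_left hy]

theorem one_div_cosh_le_profile (hL : 0 ≤ L) (y : ℝ) : 1 / cosh L ≤ profile β L y := by
  refine one_div_le_one_div_of_le (cosh_pos _) (cosh_le_cosh.2 ?_)
  rw [abs_of_nonneg (le_min hL (norm_nonneg _)), abs_of_nonneg hL]
  exact min_le_left _ _

theorem one_div_cosh_sub_le_profile (hL : 0 ≤ L) (y : ℝ) (k : ℤ) :
    1 / cosh (y - k * β) ≤ profile β L y := by
  rw [← profile_periodic.sub_int_mul_eq k (x := y)]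
  refine one_div_le_one_div_of_le (cosh_pos _) (cosh_le_cosh.2 ?_)
  rw [abs_of_nonneg (le_min hL (norm_nonneg _)), ← norm_eq_abs]
  exact (min_le_right _ _).trans QuotientAddGroup.norm_mk_le_norm

theorem integral_profile_pow (hβ : 0 < β) (hL₀ : 0 ≤ L) (hL : L ≤ β / 2) (n : ℕ) :
    ∫ y in 0..β / 2, profile β L y ^ n =
      (∫ y in 0..L, (1 / cosh y) ^ n) + (β / 2 - L) * (1 / cosh L) ^ n := by
  have hi (a b : ℝ) : IntervalIntegrable (fun y => profile β L y ^ n) volume a b :=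
    (continuous_profile.pow n).intervalIntegrable a b
  rw [← intervalIntegral.integral_add_adjacent_intervals (hi 0 L) (hi L (β / 2))]
  congr 1
  · refine intervalIntegral.integral_congr fun y hy => ?_
    rw [uIcc_of_le hL₀] at hy
    simp only [profile_of_abs_le hβ hL ((abs_of_nonneg hy.1).trans_le hy.2)]
  · rw [← smul_eq_mul, ← intervalIntegral.integral_const]
    refine intervalIntegral.integral_congr fun y hy => ?_
    rw [uIcc_of_le hL] at hy
    have hy' : |y| = y := abs_of_nonneg (hL₀.trans hy.1)
    simp only [profile_of_le_abs hβ (hy.1.trans_eq hy'.symm) (hy'.trans_le hy.2)]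

theorem integral_neg_self_of_even {f : ℝ → ℝ} (hf : Continuous f) (heven : ∀ y, f (-y) = f y)
    (a : ℝ) : ∫ y in -a..a, f y = 2 * ∫ y in 0..a, f y := by
  have h := intervalIntegral.integral_comp_neg (a := 0) (b := a) (f := f)
  simp only [heven, neg_zero] at h
  rw [← intervalIntegral.integral_add_adjacent_intervals (hf.intervalIntegrable (-a) 0)
    (hf.intervalIntegrable 0 a), ← h, two_mul]

theorem integral_neg_period_period {f : ℝ → ℝ} (hf : Continuous f)
    (hper : Function.Periodic f β) :
    ∫ y in -β..β, f y = 2 * ∫ y in -(β / 2)..β / 2, f y := by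
  have h₁ := hper.intervalIntegral_add_eq (-β) (-(β / 2))
  have h₂ := hper.intervalIntegral_add_eq 0 (-(β / 2))
  rw [show -(β / 2) + β = β / 2 by ring] at h₁ h₂
  rw [neg_add_cancel] at h₁
  rw [zero_add] at h₂
  rw [← intervalIntegral.integral_add_adjacent_intervals (hf.intervalIntegrable (-β) 0)
    (hf.intervalIntegrable 0 β), h₁, h₂, two_mul]

theorem integral_profile_sq (hβ : 0 < β) (hL₀ : 0 ≤ L) (hL : L ≤ β / 2) :
    ∫ y in -β..β, profile β L y ^ 2 = 4 * (tanh L + (β / 2 - L) * (1 / cosh L) ^ 2) := by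
  have hc : Continuous fun y => profile β L y ^ 2 := by fun_prop
  rw [integral_neg_period_period hc (fun y => by simp only [profile_periodic y]),
    integral_neg_self_of_even hc (fun y => by simp only [profile_neg]),
    integral_profile_pow hβ hL₀ hL, integral_one_div_cosh_sq, tanh_zero]
  ring

/-- The arc length along the vertical lines for the conformal factor `profile`. -/
def arcLen (β L y : ℝ) : ℝ := ∫ t in 0..y, profile β L t

theorem hasDerivAt_arcLen (y : ℝ) : HasDerivAt (arcLen β L) (profile β L y) y :=
  (continuous_profile.integral_hasStrictDerivAt 0 y).hasDerivAt

theorem arcLen_zero : arcLen β L 0 = 0 := intervalIntegral.integral_same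

theorem arcLen_neg (y : ℝ) : arcLen β L (-y) = -arcLen β L y := by
  have h := intervalIntegral.integral_comp_neg (a := 0) (b := y) (f := profile β L)
  simp only [profile_neg, neg_zero] at h
  rw [arcLen, arcLen, h, intervalIntegral.integral_symm]

theorem arcLen_add_period (y : ℝ) :
    arcLen β L (y + β) = arcLen β L y + 2 * arcLen β L (β / 2) := by
  have h := profile_periodic (β := β) (L := L) |>.intervalIntegral_add_eq y (-(β / 2))
  rw [show -(β / 2) + β = β / 2 by ring,
    integral_neg_self_of_even continuous_profile profile_neg] at h
  rw [arcLen, arcLen, arcLen, ← h, intervalIntegral.integral_add_adjacent_intervals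
    (continuous_profile.intervalIntegrable _ _) (continuous_profile.intervalIntegrable _ _)]

theorem arcLen_add_two_mul (y : ℝ) :
    arcLen β L (y + 2 * β) = arcLen β L y + 4 * arcLen β L (β / 2) := by
  rw [two_mul, ← add_assoc, arcLen_add_period, arcLen_add_period]
  ring

theorem arcLen_of_abs_le (hβ : 0 < β) (hL : L ≤ β / 2) {y : ℝ} (hy : |y| ≤ L) :
    arcLen β L y = arctan (sinh y) := by
  have h := integral_one_div_cosh 0 y
  rw [sinh_zero, arctan_zero, sub_zero] at h
  rw [← h, arcLen]
  refine intervalIntegral.integral_congr fun t ht => profile_of_abs_le hβ hL (le_trans ?_ hy)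
  simpa using abs_sub_left_of_mem_uIcc ht

theorem arcLen_half (hβ : 0 < β) (hL₀ : 0 ≤ L) (hL : L ≤ β / 2) :
    arcLen β L (β / 2) = arctan (sinh L) + (β / 2 - L) * (1 / cosh L) := by
  have h := integral_profile_pow hβ hL₀ hL 1
  simpa only [arcLen, pow_one, integral_one_div_cosh, sinh_zero, arctan_zero, sub_zero] using h

/-! ### Horizontal averages -/

theorem integral_integral_swap_of_continuous {f : ℝ → ℝ → ℝ}
    (hf : Continuous fun p : ℝ × ℝ => f p.1 p.2) (a b c d : ℝ) :
    ∫ x in a..b, ∫ y in c..d, f x y = ∫ y in c..d, ∫ x in a..b, f x y :=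
  intervalIntegral_intervalIntegral_swap
    ((hf.continuousOn.integrableOn_compact (isCompact_uIcc.prod isCompact_uIcc)).mono_set
      (prod_mono uIoc_subset_uIcc uIoc_subset_uIcc))

theorem mul_le_integral_integral_of_le {f : ℝ → ℝ → ℝ}
    (hf : Continuous fun p : ℝ × ℝ => f p.1 p.2) {B a b ℓ : ℝ} (hℓ : 0 ≤ ℓ)
    (h : ∀ x, B ≤ ∫ y in a..b, f x y) : ℓ * B ≤ ∫ y in a..b, ∫ x in 0..ℓ, f x y := by
  rw [← integral_integral_swap_of_continuous hf]
  calc ℓ * B = ∫ _ in 0..ℓ, B := by rw [intervalIntegral.integral_const, sub_zero, smul_eq_mul]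
    _ ≤ _ := intervalIntegral.integral_mono hℓ intervalIntegrable_const
      (Continuous.intervalIntegrable
        (intervalIntegral.continuous_parametric_intervalIntegral_of_continuous' hf a b) 0 ℓ) h

@[fun_prop]
theorem continuous_div_sqrt_one_add_sq {X : Type*} [TopologicalSpace X] {u v : X → ℝ}
    (hu : Continuous u) (hv : Continuous v) : Continuous fun x => u x / √(1 + v x ^ 2) :=
  hu.div (by fun_prop) fun x => (sqrt_pos.2 (by positivity)).ne'

theorem setIntegral_Ico_reProdIm_Ico {f : ℂ → ℝ} (hf : Continuous f) {a b c d : ℝ} (hab : a ≤ b)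
    (hcd : c ≤ d) :
    ∫ z in Ico a b ×ℂ Ico c d, f z = ∫ y in c..d, ∫ x in a..b, f (x + y * Complex.I) := by
  have hpre : Complex.measurableEquivRealProd.symm ⁻¹' (Ico a b ×ℂ Ico c d) =
      Ico a b ×ˢ Ico c d := by
    ext p
    simp [Complex.mem_reProdIm]
  have hsymm (p : ℝ × ℝ) : Complex.measurableEquivRealProd.symm p = p.1 + p.2 * Complex.I :=
    Complex.ext (by simp) (by simp)
  have hc : Continuous fun p : ℝ × ℝ => f (p.1 + p.2 * Complex.I) := by fun_prop
  rw [← Complex.volume_preserving_equiv_real_prod.symm.setIntegral_preimage_emb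
    (MeasurableEquiv.measurableEmbedding _), hpre]
  simp only [hsymm]
  rw [Measure.volume_eq_prod, setIntegral_prod _ ((hc.continuousOn.integrableOn_compact
    (isCompact_Icc.prod isCompact_Icc)).mono_set (prod_mono Ico_subset_Icc_self
      Ico_subset_Icc_self)),
    ← integral_integral_swap_of_continuous (f := fun x y => f (x + y * Complex.I)) hc]
  simp only [intervalIntegral.integral_of_le hab, intervalIntegral.integral_of_le hcd,
    integral_Ico_eq_integral_Ioo, integral_Ioc_eq_integral_Ioo]

attribute [local fun_prop] continuous_arsinh

namespace RiemMetric
variable (g : RiemMetric β)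

/-- The integral of the conformal factor along the horizontal line at height `y`; it is the
horizontal average of the factor up to the constant `2 * π`. -/
def rowIntegral (y : ℝ) : ℝ := ∫ x in 0..2 * π, g.coordFactor x y

@[fun_prop]
theorem continuous_rowIntegral : Continuous g.rowIntegral :=
  intervalIntegral.continuous_parametric_intervalIntegral_of_continuous'
    (f := fun y x => g.coordFactor x y) (by fun_prop) _ _

theorem rowIntegral_nonneg (y : ℝ) : 0 ≤ g.rowIntegral y :=
  intervalIntegral.integral_nonneg (by positivity) fun _ _ => (g.coordFactor_pos _ _).le

theorem integral_coordFactor_add (x₀ y : ℝ) :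
    ∫ x in 0..2 * π, g.coordFactor (x + x₀) y = g.rowIntegral y := by
  have hper : Function.Periodic (fun x => g.coordFactor x y) (2 * π) :=
    fun x => g.coordFactor_add_two_pi x y
  have h := hper.intervalIntegral_add_eq x₀ 0
  rw [intervalIntegral.integral_comp_add_right (f := fun x => g.coordFactor x y), zero_add,
    add_comm, h, zero_add, rowIntegral]

theorem rowIntegral_neg (y : ℝ) : g.rowIntegral (-y) = g.rowIntegral y := by
  rw [← g.integral_coordFactor_add π y, rowIntegral]
  simp only [coordFactor_add_pi]

theorem rowIntegral_add_two_mul (y : ℝ) : g.rowIntegral (y + 2 * β) = g.rowIntegral y := by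
  simp only [rowIntegral, coordFactor_add_two_mul]

/-- The sum of the horizontal integrals at height `y` above the two axes `y = 0` and `y = β` of the
glide reflections. -/
def pairedRowIntegral (y : ℝ) : ℝ := g.rowIntegral y + g.rowIntegral (β + y)

@[fun_prop]
theorem continuous_pairedRowIntegral : Continuous g.pairedRowIntegral := by
  unfold pairedRowIntegral
  fun_prop

theorem pairedRowIntegral_nonneg (y : ℝ) : 0 ≤ g.pairedRowIntegral y :=
  add_nonneg (g.rowIntegral_nonneg _) (g.rowIntegral_nonneg _)

theorem rowIntegral_sub (y : ℝ) : g.rowIntegral (β - y) = g.rowIntegral (β + y) := by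
  rw [← rowIntegral_neg, ← rowIntegral_add_two_mul]
  congr 1
  ring

theorem pairedRowIntegral_neg (y : ℝ) : g.pairedRowIntegral (-y) = g.pairedRowIntegral y := by
  rw [pairedRowIntegral, pairedRowIntegral, rowIntegral_neg, ← sub_eq_add_neg, rowIntegral_sub]

theorem integral_rowIntegral_mul {w : ℝ → ℝ} (hw : Continuous w) (hper : Function.Periodic w β)
    (heven : ∀ y, w (-y) = w y) :
    ∫ y in -β..β, g.rowIntegral y * w y = 2 * ∫ y in 0..β / 2, g.pairedRowIntegral y * w y := by
  have hc : Continuous fun y => g.rowIntegral y * w y := by fun_prop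
  have hsub : ∫ y in β / 2..β, g.rowIntegral y * w y =
      ∫ y in 0..β / 2, g.rowIntegral (β + y) * w y := by
    have h := intervalIntegral.integral_comp_sub_left (a := 0) (b := β / 2)
      (fun y => g.rowIntegral y * w y) β
    rw [sub_zero, sub_half] at h
    rw [← h]
    refine intervalIntegral.integral_congr fun y _ => ?_
    simp only [rowIntegral_sub, hper.sub_eq', heven]
  rw [integral_neg_self_of_even hc fun y => by rw [rowIntegral_neg, heven],
    ← intervalIntegral.integral_add_adjacent_intervals (hc.intervalIntegrable 0 (β / 2))
      (hc.intervalIntegrable _ _), hsub,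
    ← intervalIntegral.integral_add (hc.intervalIntegrable _ _)
      (Continuous.intervalIntegrable (by fun_prop) _ _)]
  simp only [pairedRowIntegral, add_mul]

theorem lv_nonneg : 0 ≤ g.lv := g.minLength_nonneg _

theorem lσ_nonneg : 0 ≤ g.lσ := le_min (g.minLength_nonneg _) (g.minLength_nonneg _)

namespace Conformal
variable {g} (hg : g.Conformal (flat β))
include hg

theorem pi_mul_lv_le (hβ : 0 < β) : π * g.lv ≤ ∫ y in 0..β / 2, g.pairedRowIntegral y := by
  have hrow := g.integral_rowIntegral_mul (w := fun _ => 1) continuous_const (fun _ => rfl)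
    fun _ => rfl
  simp only [mul_one] at hrow
  have h := mul_le_integral_integral_of_le (f := g.coordFactor) (by fun_prop) two_pi_pos.le
    (hg.lv_le hβ)
  change _ ≤ ∫ y in -β..β, g.rowIntegral y at h
  linarith

theorem two_pi_mul_lσ_le {c : ℝ} (hc : c = 0 ∨ c = β) (T : ℝ) :
    2 * π * g.lσ ≤ ∫ θ in 0..π, g.rowIntegral (c + arsinh (T * sin θ)) *
      (√(1 + T ^ 2) / √(1 + (T * sin θ) ^ 2)) := by
  let f (x θ : ℝ) : ℝ :=
    g.coordFactor (x + θ) (c + arsinh (T * sin θ)) * (√(1 + T ^ 2) / √(1 + (T * sin θ) ^ 2))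
  have hf : Continuous fun p : ℝ × ℝ => f p.1 p.2 := by fun_prop
  have h := mul_le_integral_integral_of_le hf two_pi_pos.le fun x => hg.lσ_le hc x T
  simpa only [f, intervalIntegral.integral_mul_const, integral_coordFactor_add] using h

theorem four_mul_lσ_mul_arctan_sinh_le {y : ℝ} (hy : 0 ≤ y) :
    4 * g.lσ * arctan (sinh y) ≤ ∫ t in 0..y, g.pairedRowIntegral t := by
  obtain rfl | hy := hy.eq_or_lt
  · simp
  let K (z : ℝ) : ℝ := g.pairedRowIntegral (arsinh z) / √(1 + z ^ 2)
  have hK : Continuous K := by fun_prop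
  have hK₀ (z : ℝ) : 0 ≤ K z := div_nonneg (g.pairedRowIntegral_nonneg _) (sqrt_nonneg _)
  have hcircle (T : ℝ) : 8 * π * g.lσ / √(1 + T ^ 2) ≤ ∫ θ in -π..π, K (T * sin θ) := by
    have heven (θ : ℝ) : K (T * sin (-θ)) = K (T * sin θ) := by
      simp only [K, sin_neg, mul_neg, arsinh_neg, pairedRowIntegral_neg, neg_sq]
    have hsum := add_le_add (hg.two_pi_mul_lσ_le (.inl rfl) T) (hg.two_pi_mul_lσ_le (.inr rfl) T)
    rw [← intervalIntegral.integral_add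
      (Continuous.intervalIntegrable (by fun_prop) _ _)
      (Continuous.intervalIntegrable (by fun_prop) _ _)] at hsum
    have hint : ∫ θ in 0..π, (g.rowIntegral (0 + arsinh (T * sin θ)) *
        (√(1 + T ^ 2) / √(1 + (T * sin θ) ^ 2)) + g.rowIntegral (β + arsinh (T * sin θ)) *
        (√(1 + T ^ 2) / √(1 + (T * sin θ) ^ 2))) =
        √(1 + T ^ 2) * ∫ θ in 0..π, K (T * sin θ) := by
      rw [← intervalIntegral.integral_const_mul]
      refine intervalIntegral.integral_congr fun θ _ => ?_
      simp only [K, pairedRowIntegral, zero_add]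
      ring
    rw [integral_neg_self_of_even (by fun_prop) heven, div_le_iff₀ (by positivity)]
    linarith
  have hsubst := intervalIntegral.integral_comp_mul_deriv (a := -y) (b := y)
    (fun x _ => hasDerivAt_sinh x) continuous_cosh.continuousOn hK
  have hcongr : ∫ t in -y..y, (K ∘ sinh) t * cosh t = ∫ t in -y..y, g.pairedRowIntegral t := by
    refine intervalIntegral.integral_congr fun t _ => ?_
    simp only [K, Function.comp_apply, arsinh_sinh, ← cosh_sq', sqrt_sq (cosh_pos t).le]
    exact div_mul_cancel₀ _ (cosh_pos t).ne'
  have h := le_integral_of_le_circle hK hK₀ (mul_nonneg (by positivity) g.lσ_nonneg) hcircle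
    (sinh_pos_iff.2 hy)
  rw [← sinh_neg, ← hsubst, hcongr,
    integral_neg_self_of_even g.continuous_pairedRowIntegral g.pairedRowIntegral_neg] at h
  have hπ : 8 * π * g.lσ * (arctan (sinh y) / π) = 8 * g.lσ * arctan (sinh y) := by field_simp
  linarith

theorem four_mul_lσ_mul_le_integral {L m : ℝ} (hL : 0 ≤ L) (hm : m ≤ 1 / cosh L) :
    4 * g.lσ * (tanh L - m * arctan (sinh L)) ≤
      ∫ y in 0..L, g.pairedRowIntegral y * (1 / cosh y - m) := by
  have hw (y : ℝ) : HasDerivAt (fun y => 1 / cosh y - m) (-sinh y / cosh y ^ 2) y := by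
    simp only [one_div]
    exact ((hasDerivAt_cosh y).fun_inv (cosh_pos y).ne').sub_const m
  have hw' : Continuous fun y => -sinh y / cosh y ^ 2 :=
    continuous_sinh.neg.div (by fun_prop) fun y => (pow_pos (cosh_pos y) 2).ne'
  have h := integral_mul_le_integral_mul_of_integral_le
    (a := fun y => 4 * g.lσ * (1 / cosh y)) hL (continuous_one_div_cosh.const_mul _)
    g.continuous_pairedRowIntegral hw hw'
    (fun y hy => div_nonpos_of_nonpos_of_nonneg (neg_nonpos.2 (sinh_nonneg_iff.2 hy.1))
      (sq_nonneg _))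
    (sub_nonneg.2 hm) fun y hy => by
      simpa [intervalIntegral.integral_const_mul, integral_one_div_cosh, -one_div]
        using hg.four_mul_lσ_mul_arctan_sinh_le hy.1
  refine le_trans (le_of_eq ?_) h
  have hc₁ : Continuous fun y => m * (1 / cosh y) := continuous_one_div_cosh.const_mul m
  have hc₂ : Continuous fun y => (1 / cosh y) ^ 2 := continuous_one_div_cosh.pow 2
  rw [intervalIntegral.integral_congr
      (g := fun y => 4 * g.lσ * ((1 / cosh y) ^ 2 - m * (1 / cosh y))) fun y _ => by ring,
    intervalIntegral.integral_const_mul, intervalIntegral.integral_sub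
      (hc₂.intervalIntegrable _ _) (hc₁.intervalIntegrable _ _),
    intervalIntegral.integral_const_mul, integral_one_div_cosh_sq, integral_one_div_cosh]
  simp

theorem lv_add_lσ_le_integral (hβ : 0 < β) {L m : ℝ} (hL₀ : 0 ≤ L)
    (hL : L ≤ β / 2) (hm₀ : 0 ≤ m) (hm : m ≤ 1 / cosh L) :
    2 * π * m * g.lv + 8 * (tanh L - m * arctan (sinh L)) * g.lσ ≤
      ∫ y in -β..β, g.rowIntegral y * profile β L y := by
  have hc₁ : Continuous fun y => g.pairedRowIntegral y * m := by fun_prop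
  have hc₂ : Continuous fun y => g.pairedRowIntegral y * (profile β L y - m) := by fun_prop
  have hsplit : ∫ y in 0..β / 2, g.pairedRowIntegral y * profile β L y =
      (∫ y in 0..β / 2, g.pairedRowIntegral y) * m +
        ∫ y in 0..β / 2, g.pairedRowIntegral y * (profile β L y - m) := by
    rw [← intervalIntegral.integral_mul_const, ← intervalIntegral.integral_add
      (hc₁.intervalIntegrable _ _) (hc₂.intervalIntegrable _ _)]
    simp only [← mul_add, add_sub_cancel]
  have hlσ : ∫ y in 0..L, g.pairedRowIntegral y * (1 / cosh y - m) ≤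
      ∫ y in 0..β / 2, g.pairedRowIntegral y * (profile β L y - m) := by
    rw [intervalIntegral.integral_congr
      (g := fun y => g.pairedRowIntegral y * (profile β L y - m)) fun y hy => ?_]
    · exact intervalIntegral.integral_mono_interval le_rfl hL₀ hL
        (Filter.Eventually.of_forall fun y => mul_nonneg (g.pairedRowIntegral_nonneg y)
          (sub_nonneg.2 (hm.trans (one_div_cosh_le_profile hL₀ y)))) (hc₂.intervalIntegrable _ _)
    · rw [uIcc_of_le hL₀] at hy
      simp only [profile_of_abs_le hβ hL ((abs_of_nonneg hy.1).trans_le hy.2)]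
  have hlv := mul_le_mul_of_nonneg_right (hg.pi_mul_lv_le hβ) hm₀
  rw [g.integral_rowIntegral_mul continuous_profile profile_periodic profile_neg, hsplit]
  linarith [hg.four_mul_lσ_mul_le_integral hL₀ hm]

/-! ### The upper bound -/

theorem vol_eq_integral (hβ : 0 < β) :
    g.vol = ∫ y in -β..β, ∫ x in 0..π, g.coordFactor x y ^ 2 := by
  rw [hg.vol_eq, setIntegral_Ico_reProdIm_Ico (f := fun z => g.factor z ^ 2)
    (g.continuous_factor.pow 2) pi_pos.le (by linarith)]
  rfl

theorem two_mul_vol_eq_integral (hβ : 0 < β) :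
    2 * g.vol = ∫ y in -β..β, ∫ x in 0..2 * π, g.coordFactor x y ^ 2 := by
  let A (y : ℝ) : ℝ := ∫ x in 0..π, g.coordFactor x y ^ 2
  have hA : Continuous A := intervalIntegral.continuous_parametric_intervalIntegral_of_continuous'
    (f := fun y x => g.coordFactor x y ^ 2) (by fun_prop) _ _
  have hA' : Continuous fun y => A (-y) := hA.comp continuous_neg
  have hsplit (y : ℝ) : ∫ x in 0..2 * π, g.coordFactor x y ^ 2 = A y + A (-y) := by
    have hc : Continuous fun x => g.coordFactor x y ^ 2 := by fun_prop
    have h := intervalIntegral.integral_comp_add_right (a := 0) (b := π)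
      (f := fun x => g.coordFactor x y ^ 2) π
    rw [zero_add, ← two_mul] at h
    rw [← intervalIntegral.integral_add_adjacent_intervals (hc.intervalIntegrable _ π)
      (hc.intervalIntegrable _ _), ← h]
    simp only [coordFactor_add_pi, A]
  simp only [hsplit]
  rw [intervalIntegral.integral_add (hA.intervalIntegrable _ _)
    (hA'.intervalIntegrable _ _), intervalIntegral.integral_comp_neg A,
    neg_neg, ← hg.vol_eq_integral hβ, two_mul]

theorem sq_integral_rowIntegral_mul_le (hβ : 0 < β) {w : ℝ → ℝ} (hw : Continuous w) :
    (∫ y in -β..β, g.rowIntegral y * w y) ^ 2 ≤ 4 * π * (∫ y in -β..β, w y ^ 2) * g.vol := by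
  have hk : Continuous fun y => ∫ x in 0..2 * π, g.coordFactor x y ^ 2 :=
    intervalIntegral.continuous_parametric_intervalIntegral_of_continuous'
      (f := fun y x => g.coordFactor x y ^ 2) (by fun_prop) _ _
  have hquad (c : ℝ) : 0 ≤ 2 * π * (∫ y in -β..β, w y ^ 2) * (c * c) +
      (-2 * ∫ y in -β..β, g.rowIntegral y * w y) * c + 2 * g.vol := by
    have hsq (y : ℝ) : ∫ x in 0..2 * π, (g.coordFactor x y - c * w y) ^ 2 =
        (∫ x in 0..2 * π, g.coordFactor x y ^ 2) - 2 * c * (g.rowIntegral y * w y) +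
          2 * π * (c * c) * w y ^ 2 := by
      have hc₁ : Continuous fun x => 2 * g.coordFactor x y * (c * w y) := by fun_prop
      have hc₂ : Continuous fun x => g.coordFactor x y ^ 2 := by fun_prop
      simp only [sub_sq]
      rw [intervalIntegral.integral_add (Continuous.intervalIntegrable (by fun_prop) _ _)
        intervalIntegrable_const, intervalIntegral.integral_sub (hc₂.intervalIntegrable _ _)
        (hc₁.intervalIntegrable _ _)]
      simp only [intervalIntegral.integral_mul_const, intervalIntegral.integral_const_mul,
        intervalIntegral.integral_const, smul_eq_mul, rowIntegral]
      ring
    have hnonneg : 0 ≤ ∫ y in -β..β, ∫ x in 0..2 * π, (g.coordFactor x y - c * w y) ^ 2 :=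
      intervalIntegral.integral_nonneg (by linarith) fun y _ =>
        intervalIntegral.integral_nonneg (by positivity) fun x _ => sq_nonneg _
    simp only [hsq] at hnonneg
    rw [intervalIntegral.integral_add (Continuous.intervalIntegrable (by fun_prop) _ _)
      (Continuous.intervalIntegrable (by fun_prop) _ _), intervalIntegral.integral_sub
      (hk.intervalIntegrable _ _) (Continuous.intervalIntegrable (by fun_prop) _ _),
      intervalIntegral.integral_const_mul, intervalIntegral.integral_const_mul,
      ← hg.two_mul_vol_eq_integral hβ] at hnonneg
    linarith
  have h := discrim_le_zero hquad
  rw [discrim] at h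
  linarith

theorem mul_lv_mul_lσ_le (hβ : 0 < β) {L m : ℝ} (hL₀ : 0 ≤ L) (hL : L ≤ β / 2) (hm₀ : 0 ≤ m)
    (hm : m ≤ 1 / cosh L) (hLm : 0 ≤ tanh L - m * arctan (sinh L)) :
    4 * m * (tanh L - m * arctan (sinh L)) * (g.lv * g.lσ) ≤
      (tanh L + (β / 2 - L) * (1 / cosh L) ^ 2) * g.vol := by
  set A := 2 * π * m * g.lv with hA
  set B := 8 * (tanh L - m * arctan (sinh L)) * g.lσ with hB
  have hA₀ : 0 ≤ A := mul_nonneg (by positivity) g.lv_nonneg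
  have hB₀ : 0 ≤ B := mul_nonneg (by positivity) g.lσ_nonneg
  have hsq : (A + B) ^ 2 ≤ 16 * π * (tanh L + (β / 2 - L) * (1 / cosh L) ^ 2) * g.vol :=
    calc (A + B) ^ 2 ≤ (∫ y in -β..β, g.rowIntegral y * profile β L y) ^ 2 :=
          pow_le_pow_left₀ (by positivity) (hg.lv_add_lσ_le_integral hβ hL₀ hL hm₀ hm) 2
      _ ≤ 4 * π * (∫ y in -β..β, profile β L y ^ 2) * g.vol :=
          hg.sq_integral_rowIntegral_mul_le hβ continuous_profile
      _ = _ := by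
          rw [integral_profile_sq hβ hL₀ hL]
          ring
  have hamgm : 4 * (A * B) ≤ (A + B) ^ 2 := by linarith [four_mul_le_sq_add A B]
  refine le_of_mul_le_mul_left ?_ (by positivity : 0 < 16 * π)
  calc _ = 4 * (A * B) := by
        rw [hA, hB]
        ring
    _ ≤ _ := by linarith

end Conformal
end RiemMetric

/-! ### Distances on the round sphere -/

/-- The cosine of the distance between two points of the round sphere, in the Mercator coordinates
in which the round metric is `(dx² + dy²) / cosh² y`. -/
def cosDist (w z : ℂ) : ℝ :=
  (cos (z.re - w.re) + sinh z.im * sinh w.im) / (cosh z.im * cosh w.im)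

theorem cosDist_self (w : ℂ) : cosDist w w = 1 := by
  rw [cosDist, sub_self, cos_zero, div_eq_one_iff_eq (by positivity)]
  linear_combination -cosh_sq w.im

theorem cosDist_antipodal {w z : ℂ} (hre : z.re = w.re + π) (him : z.im = -w.im) :
    cosDist w z = -1 := by
  rw [cosDist, hre, him, add_sub_cancel_left, cos_pi, sinh_neg, cosh_neg,
    div_eq_iff (by positivity)]
  linear_combination cosh_sq w.im

theorem hasFDerivAt_cosDist (w z : ℂ) :
    HasFDerivAt (cosDist w)
      ((-sin (z.re - w.re) / (cosh z.im * cosh w.im)) • Complex.reCLM +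
        ((sinh w.im - sinh z.im * cos (z.re - w.re)) / (cosh z.im ^ 2 * cosh w.im)) •
          Complex.imCLM) z := by
  have hz := (cosh_pos z.im).ne'
  have hw := (cosh_pos w.im).ne'
  have him : HasFDerivAt (fun z : ℂ => z.im) Complex.imCLM z := Complex.imCLM.hasFDerivAt
  have hcos := (Complex.reCLM.hasFDerivAt.sub_const w.re (x := z)).cos
  have h := (hcos.fun_add (him.sinh.mul_const (sinh w.im))).fun_mul
    ((hasDerivAt_inv (mul_ne_zero hz hw)).comp_hasFDerivAt z (him.cosh.mul_const (cosh w.im)))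
  refine h.congr_fderiv ?_
  ext ξ
  simp only [Complex.reCLM_apply, neg_smul, smul_neg, Function.comp_apply, mul_inv_rev, smul_add,
    _root_.add_apply, _root_.neg_apply, _root_.smul_apply, Complex.imCLM_apply, smul_eq_mul,
    neg_mul, mul_neg]
  field_simp
  linear_combination ξ.im * sinh w.im * cosh_sq z.im

theorem one_sub_cosDist_sq (w z : ℂ) :
    1 - cosDist w z ^ 2 = cosh z.im ^ 2 *
      ((-sin (z.re - w.re) / (cosh z.im * cosh w.im)) ^ 2 +
        ((sinh w.im - sinh z.im * cos (z.re - w.re)) / (cosh z.im ^ 2 * cosh w.im)) ^ 2) := by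
  have hz := (cosh_pos z.im).ne'
  have hw := (cosh_pos w.im).ne'
  rw [cosDist]
  field_simp
  rw [sin_sq, cosh_sq z.im, cosh_sq w.im]
  ring

theorem cosDist_sq_le_one (w z : ℂ) : cosDist w z ^ 2 ≤ 1 := by
  rw [← sub_nonneg, one_sub_cosDist_sq]
  positivity

theorem sq_cosh_mul_fderiv_cosDist_le (w z ξ : ℂ) :
    (cosh z.im * fderiv ℝ (cosDist w) z ξ) ^ 2 ≤ (1 - cosDist w z ^ 2) * ‖ξ‖ ^ 2 := by
  rw [(hasFDerivAt_cosDist w z).fderiv, one_sub_cosDist_sq, Complex.sq_norm, Complex.normSq_apply]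
  generalize -sin (z.re - w.re) / (cosh z.im * cosh w.im) = a
  generalize (sinh w.im - sinh z.im * cos (z.re - w.re)) / (cosh z.im ^ 2 * cosh w.im) = b
  simp only [_root_.add_apply, _root_.smul_apply, Complex.reCLM_apply,
    Complex.imCLM_apply, smul_eq_mul]
  have hcs : (a * ξ.re + b * ξ.im) ^ 2 ≤ (a ^ 2 + b ^ 2) * (ξ.re * ξ.re + ξ.im * ξ.im) := by
    linarith [sq_nonneg (a * ξ.im - b * ξ.re)]
  linarith [mul_le_mul_of_nonneg_left hcs (sq_nonneg (cosh z.im))]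

-- The factor `r < 1` keeps `arcsin` away from its non-differentiable points `±1`.
theorem abs_mul_cosDist_lt_one {r : ℝ} (hr : |r| < 1) (w z : ℂ) : |r * cosDist w z| < 1 := by
  rw [abs_mul]
  exact (mul_le_of_le_one_right (abs_nonneg r)
    ((sq_le_one_iff_abs_le_one _).1 (cosDist_sq_le_one w z))).trans_lt hr

theorem hasFDerivAt_arcsin_mul_cosDist {r : ℝ} (hr : |r| < 1) (w z : ℂ) :
    HasFDerivAt (fun z => arcsin (r * cosDist w z))
      ((1 / √(1 - (r * cosDist w z) ^ 2)) • r • fderiv ℝ (cosDist w) z) z := by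
  have h := abs_lt.1 (abs_mul_cosDist_lt_one hr w z)
  exact (hasDerivAt_arcsin h.1.ne' h.2.ne).comp_hasFDerivAt z
    ((hasFDerivAt_cosDist w z).differentiableAt.hasFDerivAt.const_mul r)

theorem abs_fderiv_arcsin_mul_cosDist_le {r : ℝ} (hr : |r| < 1) (w z ξ : ℂ) :
    |fderiv ℝ (fun z => arcsin (r * cosDist w z)) z ξ| ≤ 1 / cosh z.im * ‖ξ‖ := by
  have hC := cosh_pos z.im
  have hr₁ : r ^ 2 ≤ 1 := ((sq_lt_one_iff_abs_lt_one r).2 hr).le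
  have hS : 0 < 1 - (r * cosDist w z) ^ 2 :=
    sub_pos.2 ((sq_lt_one_iff_abs_lt_one _).2 (abs_mul_cosDist_lt_one hr w z))
  have hle : |r * (cosh z.im * fderiv ℝ (cosDist w) z ξ)| ≤
      √(1 - (r * cosDist w z) ^ 2) * ‖ξ‖ := by
    refine abs_le_of_sq_le_sq ?_ (by positivity)
    calc _ = r ^ 2 * (cosh z.im * fderiv ℝ (cosDist w) z ξ) ^ 2 := by ring
      _ ≤ r ^ 2 * ((1 - cosDist w z ^ 2) * ‖ξ‖ ^ 2) := by
        gcongr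
        exact sq_cosh_mul_fderiv_cosDist_le w z ξ
      _ = (r ^ 2 - (r * cosDist w z) ^ 2) * ‖ξ‖ ^ 2 := by ring
      _ ≤ (1 - (r * cosDist w z) ^ 2) * ‖ξ‖ ^ 2 := by gcongr
      _ = _ := by rw [mul_pow √_, sq_sqrt hS.le]
  have hS' := sqrt_pos.2 hS
  rw [(hasFDerivAt_arcsin_mul_cosDist hr w z).fderiv]
  simp only [_root_.smul_apply, smul_eq_mul]
  rw [abs_mul, abs_of_pos (one_div_pos.2 hS'), one_div_mul_eq_div, one_div_mul_eq_div,
    div_le_div_iff₀ hS' hC, mul_comm ‖ξ‖]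
  refine le_trans (le_of_eq ?_) hle
  rw [mul_left_comm, abs_mul (cosh _), abs_of_pos hC, mul_comm]

theorem PiecewiseC1.pi_le_integral_of_antipodal {γ : ℝ → ℂ} (hγ : PiecewiseC1 γ) {φ : ℂ → ℝ}
    (hφ : Continuous φ) {s : ℝ} (hle : ∀ z, 1 / cosh (z.im - s) ≤ φ z)
    (hre : (γ 1).re = (γ 0).re + π) (him : (γ 1).im - s = -((γ 0).im - s)) :
    π ≤ ∫ t in 0..1, φ (γ t) * ‖deriv γ t‖ := by
  have harcsin (r : ℝ) (hr : r ∈ Ioo (-1) 1) :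
      2 * arcsin r ≤ ∫ t in 0..1, φ (γ t) * ‖deriv γ t‖ := by
    have hr := abs_lt.2 hr
    let F (z : ℂ) : ℝ := arcsin (r * cosDist (γ 0 - s * Complex.I) z)
    have hF (z : ℂ) : DifferentiableAt ℝ F z :=
      (hasFDerivAt_arcsin_mul_cosDist hr _ z).differentiableAt
    have h := hγ.sub_le_integral hφ (G := fun z => -F (z - s * Complex.I))
      (fun z => ((hF _).comp z (differentiableAt_id.sub_const _)).neg) fun z ξ => by
        rw [fderiv_fun_neg, fderiv_comp_sub, _root_.neg_apply]
        refine (neg_le_abs _).trans ((abs_fderiv_arcsin_mul_cosDist_le hr _ _ ξ).trans ?_)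
        exact mul_le_mul_of_nonneg_right (by simpa using hle z) (norm_nonneg ξ)
    have hantipodal : cosDist (γ 0 - s * Complex.I) (γ 1 - s * Complex.I) = -1 :=
      cosDist_antipodal (by simpa using hre) (by simpa using him)
    simp only [F, cosDist_self, hantipodal, mul_one, mul_neg, arcsin_neg] at h
    linarith
  have hlim : Filter.Tendsto (fun r => 2 * arcsin r) (nhdsWithin 1 (Iio 1)) (nhds π) := by
    convert ((continuous_arcsin.const_mul 2).tendsto 1).mono_left nhdsWithin_le_nhds using 2
    rw [arcsin_one]
    ring
  exact le_of_tendsto hlim (Filter.mem_of_superset (Ioo_mem_nhdsLT (by norm_num)) harcsin)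

/-! ### The extremal metrics -/

/-- The metric with conformal factor `profile β L` relative to `g_β`: a round band of Mercator
height `L` around each of the two glide axes, joined by flat cylinders. -/
def extremal (β L : ℝ) : RiemMetric β where
  form z := profile β L z.im ^ 2 • innerₗ ℂ
  symm z ξ η := by
    simp only [LinearMap.smul_apply, innerₗ_apply_apply, real_inner_comm]
  pos z ξ hξ := by
    simp only [LinearMap.smul_apply, innerₗ_apply_apply, smul_eq_mul]
    exact mul_pos (pow_pos (profile_pos _) 2) (real_inner_self_pos.2 hξ)
  cont ξ η := by
    simp only [LinearMap.smul_apply, innerₗ_apply_apply, smul_eq_mul]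
    fun_prop
  glide_inv z ξ η := by
    rw [glide_im, profile_neg]
    simp [Complex.inner]
  vert_inv z ξ η := by
    rw [vert_im, two_mul, ← add_assoc, profile_periodic, profile_periodic]

section Extremal
variable {L : ℝ}

theorem extremal_form (z ξ η : ℂ) :
    (extremal β L).form z ξ η = profile β L z.im ^ 2 * inner ℝ ξ η := rfl

theorem conformal_extremal : (extremal β L).Conformal (flat β) :=
  ⟨fun z => profile β L z.im ^ 2, fun _ => pow_pos (profile_pos _) 2, fun _ _ _ => rfl⟩

theorem extremal_factor (z : ℂ) : (extremal β L).factor z = profile β L z.im := by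
  rw [RiemMetric.factor, extremal_form]
  simp [sqrt_sq (profile_pos _).le]

theorem extremal_length (γ : ℝ → ℂ) :
    (extremal β L).length γ = ∫ s in 0..1, profile β L (γ s).im * ‖deriv γ s‖ := by
  simp only [conformal_extremal.length_eq, extremal_factor]

theorem extremal_vol (hβ : 0 < β) (hL₀ : 0 ≤ L) (hL : L ≤ β / 2) :
    (extremal β L).vol = 4 * π * (tanh L + (β / 2 - L) * (1 / cosh L) ^ 2) := by
  rw [conformal_extremal.vol_eq_integral hβ, mul_comm 4 π, mul_assoc,
    ← integral_profile_sq hβ hL₀ hL, ← intervalIntegral.integral_const_mul]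
  simp [RiemMetric.coordFactor, extremal_factor]

theorem PiecewiseC1.abs_arcLen_sub_le_length {γ : ℝ → ℂ} (hγ : PiecewiseC1 γ) :
    |arcLen β L (γ 1).im - arcLen β L (γ 0).im| ≤ (extremal β L).length γ := by
  have hd (ε : ℝ) (z : ℂ) : HasFDerivAt (fun z : ℂ => ε * arcLen β L z.im)
      (ε • profile β L z.im • Complex.imCLM) z :=
    ((hasDerivAt_arcLen z.im).comp_hasFDerivAt z Complex.imCLM.hasFDerivAt).const_mul ε
  have hle {ε : ℝ} (hε : |ε| = 1) : ε * arcLen β L (γ 1).im - ε * arcLen β L (γ 0).im ≤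
      (extremal β L).length γ := by
    rw [extremal_length]
    refine hγ.sub_le_integral (φ := fun z => profile β L z.im)
      (G := fun z => ε * arcLen β L z.im) (by fun_prop)
      (fun z => (hd ε z).differentiableAt) fun z ξ => ?_
    rw [(hd ε z).fderiv]
    refine (le_abs_self _).trans ?_
    simp only [_root_.smul_apply, smul_eq_mul, abs_mul, hε, one_mul, abs_of_pos (profile_pos _),
      Complex.imCLM_apply]
    exact mul_le_mul_of_nonneg_left (Complex.abs_im_le_norm ξ) (profile_pos _).le
  exact abs_le'.2 ⟨by linarith [hle abs_one], by linarith [hle (abs_neg (1 : ℝ) ▸ abs_one)]⟩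

theorem four_mul_arcLen_le_lv_extremal (hβ : 0 < β) :
    4 * arcLen β L (β / 2) ≤ (extremal β L).lv := by
  refine (extremal β L).le_minLength (δ := fun s => s * (2 * Complex.I * β))
    (Complex.ofRealCLM.contDiff.mul contDiff_const) vert_mem_deckGroup (by simp [vert])
    fun γ hγ h => le_trans ?_ hγ.abs_arcLen_sub_le_length
  rcases (abs_eq (by positivity)).1 (h.abs_im_sub_im_of_vertLoop hβ hγ.continuousOn) with h | h
  · rw [eq_add_of_sub_eq' h, arcLen_add_two_mul, add_sub_cancel_left]
    exact le_abs_self _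
  · rw [show (γ 0).im = (γ 1).im + 2 * β by linarith, arcLen_add_two_mul, sub_add_cancel_left,
      abs_neg]
    exact le_abs_self _

theorem PiecewiseC1.pi_le_length_extremal (hL : 0 ≤ L) {γ : ℝ → ℂ} (hγ : PiecewiseC1 γ)
    {k : ℤ} (h : deck β 1 k (γ 0) = γ 1) : π ≤ (extremal β L).length γ := by
  rw [extremal_length]
  refine hγ.pi_le_integral_of_antipodal (φ := fun z => profile β L z.im) (by fun_prop)
    (fun z => one_div_cosh_sub_le_profile hL z.im k) ?_ ?_
  · simp [← h, deck_re]
  · rw [← h, deck_im, zpow_one]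
    ring

theorem pi_le_lσ_extremal (hβ : 0 < β) (hL : 0 ≤ L) : π ≤ (extremal β L).lσ := by
  refine le_min ?_ ?_
  · refine (extremal β L).le_minLength (δ := fun s => s * π)
      (Complex.ofRealCLM.contDiff.mul contDiff_const) glide_mem_deckGroup (by simp [glide])
      fun γ hγ h => ?_
    obtain ⟨k, hk⟩ := h.exists_deck_one_of_glideLoop hβ hγ.continuousOn
    exact hγ.pi_le_length_extremal hL hk
  · refine (extremal β L).le_minLength (δ := fun s => Complex.I * β + s * π)
      (contDiff_const.add (Complex.ofRealCLM.contDiff.mul contDiff_const))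
      (mul_mem vert_mem_deckGroup glide_mem_deckGroup) (by simp [glide, vert]; ring)
      fun γ hγ h => ?_
    obtain ⟨k, hk⟩ := h.exists_deck_one_of_glideLoop' hβ hγ.continuousOn
    exact hγ.pi_le_length_extremal hL hk

end Extremal

/-! ### Isometry with the spherical and flat-spherical models -/

theorem cos_arctan_sinh (x : ℝ) : cos (arctan (sinh x)) = 1 / cosh x := by
  rw [cos_arctan, ← cosh_sq', sqrt_sq (cosh_pos x).le]

section ArcLen
variable {L : ℝ}

theorem contDiff_arcLen : ContDiff ℝ 1 (arcLen β L) := by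
  refine contDiff_one_iff_deriv.2 ⟨fun y => (hasDerivAt_arcLen y).differentiableAt, ?_⟩
  have hderiv : deriv (arcLen β L) = profile β L := funext fun y => (hasDerivAt_arcLen y).deriv
  exact hderiv ▸ continuous_profile

theorem strictMono_arcLen : StrictMono (arcLen β L) :=
  strictMono_of_deriv_pos fun y => (hasDerivAt_arcLen y).deriv ▸ profile_pos y

theorem one_div_cosh_mul_le_arcLen (hL : 0 ≤ L) {y : ℝ} (hy : 0 ≤ y) :
    1 / cosh L * y ≤ arcLen β L y :=
  calc 1 / cosh L * y = ∫ _ in 0..y, 1 / cosh L := by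
        rw [intervalIntegral.integral_const, sub_zero, smul_eq_mul, mul_comm]
    _ ≤ arcLen β L y := intervalIntegral.integral_mono_on hy intervalIntegrable_const
        (continuous_profile.intervalIntegrable _ _) fun t _ => one_div_cosh_le_profile hL t

theorem surjective_arcLen (hL : 0 ≤ L) : Function.Surjective (arcLen β L) := by
  have htop : Filter.Tendsto (arcLen β L) Filter.atTop Filter.atTop :=
    Filter.tendsto_atTop_mono' _
      ((Filter.eventually_ge_atTop 0).mono fun y => one_div_cosh_mul_le_arcLen hL)
      (Filter.tendsto_id.const_mul_atTop (one_div_pos.2 (cosh_pos L)))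
  have hodd : arcLen β L = fun y => -arcLen β L (-y) := by simp only [arcLen_neg, neg_neg]
  refine contDiff_arcLen.continuous.surjective htop ?_
  rw [hodd]
  exact Filter.tendsto_neg_atTop_atBot.comp (htop.comp Filter.tendsto_neg_atBot_atTop)

theorem abs_arcLen (y : ℝ) : |arcLen β L y| = arcLen β L |y| := by
  have hmono := strictMono_arcLen.monotone (f := arcLen β L)
  rcases le_total 0 y with h | h
  · rw [abs_of_nonneg h, abs_of_nonneg (arcLen_zero.symm.trans_le (hmono h))]
  · rw [abs_of_nonpos h, arcLen_neg, abs_of_nonpos ((hmono h).trans_eq arcLen_zero)]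

theorem arcLen_deck_im (n k : ℤ) (z : ℂ) : arcLen β L (deck β n k z).im =
    (-1) ^ n * arcLen β L z.im + 2 * (2 * arcLen β L (β / 2)) * k := by
  have hneg : arcLen β L ((-1) ^ n * z.im) = (-1) ^ n * arcLen β L z.im := by
    rcases n.even_or_odd with h | h
    · simp only [h.neg_one_zpow, one_mul]
    · simp only [h.neg_one_zpow, neg_one_mul, arcLen_neg]
  have h := AddConstMapClass.map_add_zsmul
    (⟨arcLen β L, arcLen_add_two_mul⟩ : AddConstMap ℝ ℝ (2 * β) (4 * arcLen β L (β / 2)))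
    ((-1) ^ n * z.im) k
  simp only [AddConstMap.coe_mk, zsmul_eq_mul, hneg] at h
  rw [deck_im, mul_comm (2 * β), h]
  ring

/-- The arc length `arcLen β L`, as a homeomorphism of the line. -/
def arcLenHomeo (β : ℝ) (hL : 0 ≤ L) : ℝ ≃ₜ ℝ :=
  (strictMono_arcLen.orderIsoOfSurjective (arcLen β L) (surjective_arcLen hL)).toHomeomorph

theorem arcLenHomeo_apply (hL : 0 ≤ L) (y : ℝ) : arcLenHomeo β hL y = arcLen β L y := rfl

theorem contDiff_arcLenHomeo_symm (hL : 0 ≤ L) : ContDiff ℝ 1 (arcLenHomeo β hL).symm :=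
  (arcLenHomeo β hL).contDiff_symm_deriv (fun y => (profile_pos y).ne') hasDerivAt_arcLen
    contDiff_arcLen

/-- The change of coordinates `x + iy ↦ x + i arcLen(y)`, which brings the extremal metric into
the form `f(v)² du² + dv²`. -/
def coordChange (β : ℝ) (hL : 0 ≤ L) : ℂ ≃ₜ ℂ where
  toFun z := z.re + arcLenHomeo β hL z.im * Complex.I
  invFun z := z.re + (arcLenHomeo β hL).symm z.im * Complex.I
  left_inv z := by apply Complex.ext <;> simp
  right_inv z := by apply Complex.ext <;> simp
  continuous_toFun := by fun_prop
  continuous_invFun := by fun_prop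

theorem coordChange_re (hL : 0 ≤ L) (z : ℂ) : (coordChange β hL z).re = z.re := by
  simp [coordChange]

theorem coordChange_im (hL : 0 ≤ L) (z : ℂ) : (coordChange β hL z).im = arcLen β L z.im := by
  simp [coordChange, arcLenHomeo_apply]

theorem contDiff_re_add_comp_im_mul_I {e : ℝ → ℝ} (he : ContDiff ℝ 1 e) :
    ContDiff ℝ 1 fun z : ℂ => (z.re : ℂ) + e z.im * Complex.I :=
  (Complex.ofRealCLM.contDiff.comp Complex.reCLM.contDiff).add
    ((Complex.ofRealCLM.contDiff.comp (he.comp Complex.imCLM.contDiff)).mul contDiff_const)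

theorem hasFDerivAt_coordChange (hL : 0 ≤ L) (z : ℂ) :
    HasFDerivAt (coordChange β hL) (Complex.ofRealCLM.comp Complex.reCLM +
      Complex.I • Complex.ofRealCLM.comp (profile β L z.im • Complex.imCLM)) z := by
  have him := Complex.ofRealCLM.hasFDerivAt.comp z
    ((hasDerivAt_arcLen (β := β) (L := L) z.im).comp_hasFDerivAt z Complex.imCLM.hasFDerivAt)
  exact (Complex.ofRealCLM.comp Complex.reCLM).hasFDerivAt.add (him.mul_const Complex.I)

theorem fderiv_coordChange_re (hL : 0 ≤ L) (z ξ : ℂ) :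
    (fderiv ℝ (coordChange β hL) z ξ).re = ξ.re := by
  simp [(hasFDerivAt_coordChange hL z).fderiv]

theorem fderiv_coordChange_im (hL : 0 ≤ L) (z ξ : ℂ) :
    (fderiv ℝ (coordChange β hL) z ξ).im = profile β L z.im * ξ.im := by
  simp [(hasFDerivAt_coordChange hL z).fderiv]

theorem proj_eq_proj_iff_coordChange (hL : 0 ≤ L) (z w : ℂ) :
    proj β z = proj β w ↔ proj (2 * arcLen β L (β / 2)) (coordChange β hL z) =
      proj (2 * arcLen β L (β / 2)) (coordChange β hL w) := by
  have hdeck (n k : ℤ) : deck (2 * arcLen β L (β / 2)) n k (coordChange β hL z) =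
      coordChange β hL (deck β n k z) := by
    apply Complex.ext
    · simp only [deck_re, coordChange_re]
    · rw [deck_im, coordChange_im, coordChange_im, arcLen_deck_im]
  simp only [proj_eq_proj_iff, hdeck, EmbeddingLike.apply_eq_iff_eq]

end ArcLen

/-- The metric `f(v)² du² + dv²` in the coordinates `z = u + i v`. -/
def warped {f : ℝ → ℝ} (hf : Continuous f) (hpos : ∀ v, 0 < f v) (heven : ∀ v, f (-v) = f v)
    (hper : Function.Periodic f (2 * β)) : RiemMetric β where
  form z := LinearMap.mk₂ ℝ (fun ξ η => f z.im ^ 2 * (ξ.re * η.re) + ξ.im * η.im)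
    (fun _ _ _ => by simp only [Complex.add_re, Complex.add_im]; ring)
    (fun _ _ _ => by simp only [Complex.smul_re, Complex.smul_im, smul_eq_mul]; ring)
    (fun _ _ _ => by simp only [Complex.add_re, Complex.add_im]; ring)
    (fun _ _ _ => by simp only [Complex.smul_re, Complex.smul_im, smul_eq_mul]; ring)
  symm z ξ η := by
    simp only [LinearMap.mk₂_apply]
    ring
  pos z ξ hξ := by
    have hre := mul_nonneg (sq_nonneg (f z.im)) (mul_self_nonneg ξ.re)
    by_cases h : ξ.im = 0
    · have hξ' : ξ.re ≠ 0 := fun h' => hξ (Complex.ext h' h)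
      exact add_pos_of_pos_of_nonneg (mul_pos (pow_pos (hpos _) 2) (mul_self_pos.2 hξ'))
        (mul_self_nonneg ξ.im)
    · exact add_pos_of_nonneg_of_pos hre (mul_self_pos.2 h)
  cont ξ η := by
    simp only [LinearMap.mk₂_apply]
    fun_prop
  glide_inv z ξ η := by
    simp only [LinearMap.mk₂_apply, glide_im, heven, Complex.conj_re, Complex.conj_im, neg_mul_neg]
  vert_inv z ξ η := by
    simp only [LinearMap.mk₂_apply, vert_im, hper z.im]

section Model
variable {L : ℝ}

/-- The conformal factor of the extremal metric as a function of the arc length. -/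
def arcProfile (β : ℝ) (hL : 0 ≤ L) (v : ℝ) : ℝ := profile β L ((arcLenHomeo β hL).symm v)

@[fun_prop]
theorem continuous_arcProfile (hL : 0 ≤ L) : Continuous (arcProfile β hL) :=
  continuous_profile.comp (arcLenHomeo β hL).symm.continuous

theorem arcProfile_arcLen (hL : 0 ≤ L) (y : ℝ) :
    arcProfile β hL (arcLen β L y) = profile β L y := by
  rw [arcProfile, ← arcLenHomeo_apply hL, Homeomorph.symm_apply_apply]

theorem arcProfile_pos (hL : 0 ≤ L) (v : ℝ) : 0 < arcProfile β hL v := profile_pos _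

theorem arcProfile_periodic (hL : 0 ≤ L) :
    Function.Periodic (arcProfile β hL) (2 * arcLen β L (β / 2)) := fun v => by
  obtain ⟨y, rfl⟩ := surjective_arcLen (β := β) hL v
  rw [← arcLen_add_period, arcProfile_arcLen, arcProfile_arcLen, profile_periodic]

theorem arcProfile_neg (hL : 0 ≤ L) (v : ℝ) : arcProfile β hL (-v) = arcProfile β hL v := by
  obtain ⟨y, rfl⟩ := surjective_arcLen (β := β) hL v
  rw [← arcLen_neg, arcProfile_arcLen, arcProfile_arcLen, profile_neg]

theorem arcProfile_of_abs_le (hβ : 0 < β) (hL : 0 ≤ L) (hLβ : L ≤ β / 2) {v : ℝ}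
    (hv : |v| ≤ arctan (sinh L)) : arcProfile β hL v = cos v := by
  obtain ⟨y, rfl⟩ := surjective_arcLen (β := β) hL v
  rw [abs_arcLen, ← arcLen_of_abs_le hβ hLβ (abs_of_nonneg hL).le,
    strictMono_arcLen.le_iff_le] at hv
  rw [arcProfile_arcLen, profile_of_abs_le hβ hLβ hv, arcLen_of_abs_le hβ hLβ hv, cos_arctan_sinh]

theorem arcProfile_of_le_abs (hβ : 0 < β) (hL : 0 ≤ L) (hLβ : L ≤ β / 2) {v : ℝ}
    (hv : arctan (sinh L) ≤ |v|) (hv' : |v| ≤ arcLen β L (β / 2)) :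
    arcProfile β hL v = cos (arctan (sinh L)) := by
  obtain ⟨y, rfl⟩ := surjective_arcLen (β := β) hL v
  rw [abs_arcLen, strictMono_arcLen.le_iff_le] at hv'
  rw [abs_arcLen, ← arcLen_of_abs_le hβ hLβ (abs_of_nonneg hL).le,
    strictMono_arcLen.le_iff_le] at hv
  rw [arcProfile_arcLen, profile_of_le_abs hβ hv hv', cos_arctan_sinh]

/-- The extremal metric in the coordinates `(u, v)` of `coordChange`. -/
def model (β : ℝ) (hL : 0 ≤ L) : RiemMetric (2 * arcLen β L (β / 2)) :=
  warped (continuous_arcProfile hL) (arcProfile_pos hL) (arcProfile_neg hL)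
    (two_mul (2 * arcLen β L (β / 2)) ▸ (arcProfile_periodic hL).add_period
      (arcProfile_periodic hL))

theorem isometric_extremal_model (hL : 0 ≤ L) : (extremal β L).Isometric (model β hL) := by
  refine ⟨coordChange β hL, contDiff_re_add_comp_im_mul_I contDiff_arcLen,
    contDiff_re_add_comp_im_mul_I (contDiff_arcLenHomeo_symm hL),
    proj_eq_proj_iff_coordChange hL, fun z ξ η => ?_⟩
  rw [extremal_form]
  simp only [model, warped, LinearMap.mk₂_apply, coordChange_im, arcProfile_arcLen,
    fderiv_coordChange_re, fderiv_coordChange_im, Complex.inner, Complex.mul_re, Complex.conj_re,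
    Complex.conj_im]
  ring

theorem isFlatSpherical_extremal (hβ : 0 < β) (hL : 0 ≤ L) (hLβ : L ≤ β / 2) :
    (extremal β L).IsFlatSpherical (arcLen β L (β / 2)) (arctan (sinh L)) :=
  ⟨model β hL, ⟨arcProfile β hL, arcProfile_periodic hL,
    fun _ => arcProfile_of_abs_le hβ hL hLβ, fun _ => arcProfile_of_le_abs hβ hL hLβ,
    fun _ _ _ => rfl⟩, isometric_extremal_model hL⟩

end Model

theorem RiemMetric.IsFlatSpherical.isSpherical {g : RiemMetric β} {b : ℝ}
    (h : g.IsFlatSpherical b b) : g.IsSpherical b := by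
  obtain ⟨h, ⟨f, hper, hcos, -, hf⟩, hiso⟩ := h
  exact ⟨h, ⟨f, hper, hcos, hf⟩, hiso⟩

/-! ### The parameters of the extremal metrics -/

/-- The height in the Mercator projection of the latitude `ω`, that is, the inverse
Gudermannian function; the parameter `L` of an extremal metric is expressed through it. -/
def mercator (ω : ℝ) : ℝ := arsinh (tan ω)

theorem mercator_arctan_sinh (t : ℝ) : mercator (arctan (sinh t)) = t := by
  rw [mercator, tan_arctan, arsinh_sinh]

theorem Ioo_zero_subset : Ioo 0 (π / 2) ⊆ Ioo (-(π / 2)) (π / 2) :=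
  Ioo_subset_Ioo_left (neg_nonpos.2 pi_div_two_pos.le)

section Mercator
variable {ω : ℝ}

theorem mercator_pos (hω : ω ∈ Ioo 0 (π / 2)) : 0 < mercator ω :=
  arsinh_pos_iff.2 (tan_pos_of_pos_of_lt_pi_div_two hω.1 hω.2)

theorem arctan_sinh_mercator (hω : ω ∈ Ioo (-(π / 2)) (π / 2)) :
    arctan (sinh (mercator ω)) = ω := by
  rw [mercator, sinh_arsinh, arctan_tan hω.1 hω.2]

theorem one_div_cosh_mercator (hω : ω ∈ Ioo (-(π / 2)) (π / 2)) :
    1 / cosh (mercator ω) = cos ω := by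
  rw [← cos_arctan_sinh, arctan_sinh_mercator hω]

theorem tanh_mercator (hω : ω ∈ Ioo (-(π / 2)) (π / 2)) : tanh (mercator ω) = sin ω := by
  rw [tanh_eq_sinh_div_cosh, div_eq_mul_one_div, one_div_cosh_mercator hω, mercator, sinh_arsinh,
    tan_mul_cos (cos_pos_of_mem_Ioo hω).ne']

theorem strictMonoOn_mercator : StrictMonoOn mercator (Ioo (-(π / 2)) (π / 2)) :=
  fun _ hx _ hy hxy => arsinh_strictMono (strictMonoOn_tan hx hy hxy)

theorem log_tan_eq_mercator (hω : ω ∈ Ioo (-(π / 2)) (π / 2)) :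
    log (tan (π / 4 + ω / 2)) = mercator ω := by
  have hcos := cos_pos_of_mem_Ioo hω
  have hcos' : 0 < cos (π / 4 + ω / 2) :=
    cos_pos_of_mem_Ioo ⟨by linarith [hω.1, pi_pos], by linarith [hω.2]⟩
  have hexp : tan (π / 4 + ω / 2) = tan ω + (cos ω)⁻¹ := by
    obtain ⟨t, rfl⟩ : ∃ t, ω = 2 * t := ⟨ω / 2, by ring⟩
    rw [mul_div_cancel_left₀ t two_ne_zero] at hcos' ⊢
    rw [tan_eq_sin_div_cos, tan_eq_sin_div_cos, ← one_div, ← add_div,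
      div_eq_div_iff hcos'.ne' hcos.ne', sin_add, cos_add, sin_pi_div_four, cos_pi_div_four,
      sin_two_mul, cos_two_mul']
    linear_combination (√2 / 2 * (cos t - sin t)) * sin_sq_add_cos_sq t
  rw [hexp, mercator, arsinh, ← inv_sqrt_one_add_tan_sq hcos, inv_inv]

end Mercator

theorem strictMonoOn_tan_div_self : StrictMonoOn (fun x => tan x / x) (Ioo 0 (π / 2)) := by
  have hcos {x : ℝ} (hx : x ∈ Ico 0 (π / 2)) : 0 < cos x :=
    cos_pos_of_mem_Ioo ⟨by linarith [hx.1, pi_pos], hx.2⟩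
  have hconv : StrictConvexOn ℝ (Ico 0 (π / 2)) tan := by
    refine StrictMonoOn.strictConvexOn_of_deriv (convex_Ico _ _)
      (fun x hx => (continuousAt_tan.2 (hcos hx).ne').continuousWithinAt) ?_
    rw [interior_Ico]
    intro x hx y hy hxy
    have hcosy := hcos (Ioo_subset_Ico_self hy)
    rw [deriv_tan, deriv_tan]
    exact one_div_lt_one_div_of_lt (pow_pos hcosy 2)
      (pow_lt_pow_left₀ (cos_lt_cos_of_nonneg_of_le_pi_div_two hx.1.le hy.2.le hxy) hcosy.le
        two_ne_zero)
  intro x hx y hy hxy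
  simpa using hconv.secant_strict_mono (a := 0) ⟨le_rfl, pi_div_two_pos⟩ (Ioo_subset_Ico_self hx)
    (Ioo_subset_Ico_self hy) hx.1.ne' hy.1.ne' hxy

theorem exp_sub_one_div_exp_add_one (x : ℝ) : (exp x - 1) / (exp x + 1) = tanh (x / 2) := by
  have hexp : exp x = exp (x / 2) ^ 2 := by rw [← exp_nat_mul, Nat.cast_two,
    mul_div_cancel₀ x two_ne_zero]
  rw [tanh_eq_sinh_div_cosh, sinh_eq, cosh_eq, exp_neg, hexp]
  field_simp

/-- The conformal parameter of the flat-spherical metric with parameters `ω` and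
`b = tan ω - ω`. -/
def modulus (ω : ℝ) : ℝ := 2 * mercator ω + 2 * ((tan ω - 2 * ω) * (1 / cos ω))

theorem continuousOn_modulus : ContinuousOn modulus (Ioo (-(π / 2)) (π / 2)) := fun x hx => by
  have hcos := (cos_pos_of_mem_Ioo hx).ne'
  have htan := continuousAt_tan.2 hcos
  have hinv : ContinuousAt (fun x => 1 / cos x) x :=
    continuousAt_const.div continuous_cos.continuousAt hcos
  exact ((htan.arsinh.const_mul 2).add
    (((htan.sub (continuousAt_id.const_mul 2)).mul hinv).const_mul 2)).continuousWithinAt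

theorem flatSpherical_equation_iff {ω : ℝ} (hω : ω ∈ Ioo (-(π / 2)) (π / 2)) :
    2 * sin ω = (β - 2 * log (tan (π / 4 + ω / 2))) * cos ω ^ 2 + 4 * ω * cos ω ↔
      modulus ω = β := by
  have hcos := (cos_pos_of_mem_Ioo hω).ne'
  have hmod : cos ω ^ 2 * (modulus ω - β) =
      2 * sin ω - ((β - 2 * mercator ω) * cos ω ^ 2 + 4 * ω * cos ω) := by
    rw [modulus, ← tan_mul_cos hcos]
    field_simp
    ring
  rw [log_tan_eq_mercator hω, ← sub_eq_zero, ← hmod, mul_eq_zero, sub_eq_zero]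
  exact or_iff_right (pow_ne_zero 2 hcos)

section Threshold
variable {b₀ : ℝ}

theorem tan_le_two_mul_of_le (hb₀ : b₀ ∈ Ioo 0 (π / 2)) (htan : tan b₀ = 2 * b₀) {b : ℝ}
    (hb : b ∈ Ioc 0 b₀) : tan b ≤ 2 * b := by
  have h := strictMonoOn_tan_div_self.monotoneOn ⟨hb.1, hb.2.trans_lt hb₀.2⟩ hb₀ hb.2
  simp only [htan] at h
  rwa [mul_div_cancel_right₀ _ hb₀.1.ne', div_le_iff₀ hb.1] at h

theorem two_mul_lt_tan_of_lt (hb₀ : b₀ ∈ Ioo 0 (π / 2)) (htan : tan b₀ = 2 * b₀) {ω : ℝ}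
    (hω : ω ∈ Ioo b₀ (π / 2)) : 2 * ω < tan ω := by
  have hω₀ : 0 < ω := hb₀.1.trans hω.1
  have h := strictMonoOn_tan_div_self hb₀ ⟨hω₀, hω.2⟩ hω.1
  simp only [htan] at h
  rwa [mul_div_cancel_right₀ _ hb₀.1.ne', lt_div_iff₀ hω₀] at h

theorem two_mul_le_tan_of_le (hb₀ : b₀ ∈ Ioo 0 (π / 2)) (htan : tan b₀ = 2 * b₀) {ω : ℝ}
    (hω : ω ∈ Ico b₀ (π / 2)) : 2 * ω ≤ tan ω := by
  rcases hω.1.eq_or_lt with rfl | h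
  · exact htan.ge
  · exact (two_mul_lt_tan_of_lt hb₀ htan ⟨h, hω.2⟩).le

theorem strictMonoOn_modulus (hb₀ : b₀ ∈ Ioo 0 (π / 2)) (htan : tan b₀ = 2 * b₀) :
    StrictMonoOn modulus (Ico b₀ (π / 2)) := by
  intro x hx y hy hxy
  have hx' : x ∈ Ioo 0 (π / 2) := ⟨hb₀.1.trans_le hx.1, hx.2⟩
  have hy' : y ∈ Ioo 0 (π / 2) := ⟨hx'.1.trans hxy, hy.2⟩
  have hcosy := cos_pos_of_mem_Ioo (Ioo_zero_subset hy')
  have hcos : 1 / cos x ≤ 1 / cos y := one_div_le_one_div_of_le hcosy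
    (cos_lt_cos_of_nonneg_of_le_pi_div_two hx'.1.le hy.2.le hxy).le
  have hgapx : 0 ≤ tan x - 2 * x := sub_nonneg.2 (two_mul_le_tan_of_le hb₀ htan hx)
  have hgap : tan x - 2 * x ≤ tan y - 2 * y :=
    calc tan x - 2 * x = x * (tan x / x - 2) := by
          rw [mul_sub, mul_div_cancel₀ _ hx'.1.ne', mul_comm x 2]
      _ ≤ y * (tan y / y - 2) := by
          refine mul_le_mul hxy.le (sub_le_sub_right (strictMonoOn_tan_div_self hx' hy' hxy).le 2)
            ?_ hy'.1.le
          rw [sub_nonneg, le_div_iff₀ hx'.1]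
          exact two_mul_le_tan_of_le hb₀ htan hx
      _ = tan y - 2 * y := by rw [mul_sub, mul_div_cancel₀ _ hy'.1.ne', mul_comm y 2]
  have hprod : (tan x - 2 * x) * (1 / cos x) ≤ (tan y - 2 * y) * (1 / cos y) :=
    (mul_le_mul_of_nonneg_left hcos hgapx).trans
      (mul_le_mul_of_nonneg_right hgap (one_div_pos.2 hcosy).le)
  have hmer := strictMonoOn_mercator (Ioo_zero_subset hx') (Ioo_zero_subset hy') hxy
  rw [modulus, modulus]
  linarith

theorem exists_mercator_eq (hb₀ : b₀ ∈ Ioo 0 (π / 2)) (hβ : 0 < β)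
    (hle : β ≤ 2 * mercator b₀) : ∃ b ∈ Ioc 0 b₀, mercator b = β / 2 := by
  refine ⟨arctan (sinh (β / 2)), ⟨arctan_pos.2 (sinh_pos_iff.2 (half_pos hβ)), ?_⟩,
    mercator_arctan_sinh _⟩
  rw [← strictMonoOn_mercator.le_iff_le (arctan_mem_Ioo _) (Ioo_zero_subset hb₀),
    mercator_arctan_sinh]
  linarith

theorem exists_modulus_eq (hb₀ : b₀ ∈ Ioo 0 (π / 2)) (htan : tan b₀ = 2 * b₀)
    (hlt : 2 * mercator b₀ < β) : ∃ ω ∈ Ioo b₀ (π / 2), modulus ω = β := by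
  obtain ⟨c, hc, hcβ⟩ : ∃ c ∈ Ioo (-(π / 2)) (π / 2), mercator c = β / 2 :=
    ⟨_, arctan_mem_Ioo _, mercator_arctan_sinh _⟩
  have hb₀c : b₀ < c := by
    rw [← strictMonoOn_mercator.lt_iff_lt (Ioo_zero_subset hb₀) hc]
    linarith
  have hmod₀ : modulus b₀ < β := by rwa [modulus, htan, sub_self, zero_mul, mul_zero, add_zero]
  have hmodc : β ≤ modulus c := by
    have h := mul_nonneg (sub_nonneg.2 (two_mul_le_tan_of_le hb₀ htan ⟨hb₀c.le, hc.2⟩))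
      (one_div_pos.2 (cos_pos_of_mem_Ioo hc)).le
    rw [modulus]
    linarith
  obtain ⟨ω, hω, heq⟩ := intermediate_value_Ioc hb₀c.le
    (continuousOn_modulus.mono (Icc_subset_Ioo (Ioo_zero_subset hb₀).1 hc.2)) ⟨hmod₀, hmodc⟩
  exact ⟨ω, ⟨hω.1, hω.2.trans_lt hc.2⟩, heq⟩

end Threshold

/-! ### Balanced parameters -/

/-- The relations between `β`, the latitude `ω` and the slope `m` under which the bound of
`RiemMetric.Conformal.mul_lv_mul_lσ_le` is attained by `extremal β (mercator ω)`; the common value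
of `lv * lσ / vol` is then `1 / (2 * m)`. The last relation is complementary slackness for the
inequalities `mercator ω ≤ β / 2` and `m ≤ cos ω`: the metric is spherical, or `m = cos ω`. -/
structure IsBalanced (β ω m : ℝ) : Prop where
  mem_Ioo : ω ∈ Ioo 0 (π / 2)
  mercator_le : mercator ω ≤ β / 2
  slope_pos : 0 < m
  slope_le : m ≤ cos ω
  sin_eq : sin ω = m * (ω + arcLen β (mercator ω) (β / 2))
  slackness : (β / 2 - mercator ω) * (cos ω - m) = 0

theorem arcLen_mercator_half {ω : ℝ} (hβ : 0 < β) (hω : ω ∈ Ioo 0 (π / 2))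
    (hωβ : mercator ω ≤ β / 2) :
    arcLen β (mercator ω) (β / 2) = ω + (β / 2 - mercator ω) * cos ω := by
  rw [arcLen_half hβ (mercator_pos hω).le hωβ, arctan_sinh_mercator (Ioo_zero_subset hω),
    one_div_cosh_mercator (Ioo_zero_subset hω)]

theorem isFlatSpherical_extremal_mercator {ω : ℝ} (hβ : 0 < β) (hω : ω ∈ Ioo 0 (π / 2))
    (hωβ : mercator ω ≤ β / 2) :
    (extremal β (mercator ω)).IsFlatSpherical (arcLen β (mercator ω) (β / 2)) ω := by
  have h := isFlatSpherical_extremal hβ (mercator_pos hω).le hωβ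
  rwa [arctan_sinh_mercator (Ioo_zero_subset hω)] at h

namespace IsBalanced
variable {ω m : ℝ}

theorem pos (h : IsBalanced β ω m) : 0 < β := by
  linarith [mercator_pos h.mem_Ioo, h.mercator_le]

theorem vol_eq (h : IsBalanced β ω m) : sin ω + (β / 2 - mercator ω) * cos ω ^ 2 =
    2 * m * arcLen β (mercator ω) (β / 2) := by
  have hsin := h.sin_eq
  rw [arcLen_mercator_half h.pos h.mem_Ioo h.mercator_le] at hsin ⊢
  linear_combination hsin + cos ω * h.slackness

theorem lv_mul_lσ_le (h : IsBalanced β ω m) {g : RiemMetric β} (hg : g.Conformal (flat β)) :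
    g.lv * g.lσ ≤ 1 / (2 * m) * g.vol := by
  have hm := h.slope_pos
  have hω := Ioo_zero_subset h.mem_Ioo
  have hlen : 0 < arcLen β (mercator ω) (β / 2) := by
    rw [← arcLen_zero (β := β) (L := mercator ω)]
    exact strictMono_arcLen (half_pos h.pos)
  have hslope : sin ω - m * ω = m * arcLen β (mercator ω) (β / 2) := by
    linear_combination h.sin_eq
  have hbound := hg.mul_lv_mul_lσ_le h.pos (mercator_pos h.mem_Ioo).le h.mercator_le hm.le
    (h.slope_le.trans_eq (one_div_cosh_mercator hω).symm)
  rw [tanh_mercator hω, arctan_sinh_mercator hω, one_div_cosh_mercator hω, hslope, h.vol_eq]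
    at hbound
  rw [one_div_mul_eq_div, le_div_iff₀' (by positivity)]
  refine le_of_mul_le_mul_left ?_ (by positivity : 0 < 2 * m * arcLen β (mercator ω) (β / 2))
  linarith [hbound (mul_pos hm hlen).le]

theorem extremal_lv_mul_lσ (h : IsBalanced β ω m) :
    (extremal β (mercator ω)).lv * (extremal β (mercator ω)).lσ =
      1 / (2 * m) * (extremal β (mercator ω)).vol := by
  refine (h.lv_mul_lσ_le conformal_extremal).antisymm ?_
  have hm := h.slope_pos.ne'
  have hL := (mercator_pos h.mem_Ioo).le
  have hω := Ioo_zero_subset h.mem_Ioo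
  rw [extremal_vol h.pos hL h.mercator_le, tanh_mercator hω, one_div_cosh_mercator hω, h.vol_eq]
  calc 1 / (2 * m) * (4 * π * (2 * m * arcLen β (mercator ω) (β / 2)))
      = 4 * arcLen β (mercator ω) (β / 2) * π := by field_simp
    _ ≤ (extremal β (mercator ω)).lv * (extremal β (mercator ω)).lσ :=
      mul_le_mul (four_mul_arcLen_le_lv_extremal h.pos) (pi_le_lσ_extremal h.pos hL) pi_pos.le
        (RiemMetric.lv_nonneg _)

end IsBalanced

section Spherical
variable {b : ℝ}

theorem arcLen_mercator_eq_self (hβ : 0 < β) (hb : b ∈ Ioo 0 (π / 2))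
    (hbβ : mercator b = β / 2) : arcLen β (mercator b) (β / 2) = b := by
  rw [arcLen_mercator_half hβ hb hbβ.le, hbβ, sub_self, zero_mul, add_zero]

theorem isBalanced_spherical (hβ : 0 < β) (hb : b ∈ Ioo 0 (π / 2)) (hbβ : mercator b = β / 2)
    (htan : tan b ≤ 2 * b) : IsBalanced β b (sin b / (2 * b)) where
  mem_Ioo := hb
  mercator_le := hbβ.le
  slope_pos := div_pos (sin_pos_of_pos_of_lt_pi hb.1 (by linarith [hb.2, pi_pos]))
    (mul_pos two_pos hb.1)
  slope_le := by
    have hcos := cos_pos_of_mem_Ioo (Ioo_zero_subset hb)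
    rw [div_le_iff₀' (mul_pos two_pos hb.1), ← tan_mul_cos hcos.ne']
    exact mul_le_mul_of_nonneg_right htan hcos.le
  sin_eq := by
    rw [arcLen_mercator_eq_self hβ hb hbβ, ← two_mul,
      div_mul_cancel₀ _ (mul_pos two_pos hb.1).ne']
  slackness := by rw [hbβ, sub_self, zero_mul]

theorem isSpherical_extremal (hβ : 0 < β) (hb : b ∈ Ioo 0 (π / 2)) (hbβ : mercator b = β / 2) :
    (extremal β (mercator b)).IsSpherical b := by
  have h := isFlatSpherical_extremal_mercator hβ hb hbβ.le
  rw [arcLen_mercator_eq_self hβ hb hbβ] at h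
  exact h.isSpherical

theorem arcsin_div_self_eq (hb : b ∈ Ioo 0 (π / 2)) (hbβ : mercator b = β / 2) :
    arcsin ((exp β - 1) / (exp β + 1)) / ((exp β - 1) / (exp β + 1)) =
      1 / (2 * (sin b / (2 * b))) := by
  have hb' := Ioo_zero_subset hb
  rw [exp_sub_one_div_exp_add_one, ← hbβ, tanh_mercator hb', arcsin_sin hb'.1.le hb'.2.le]
  have hb₀ := hb.1.ne'
  field_simp

end Spherical

section FlatSpherical
variable {ω : ℝ}

theorem half_sub_mercator_mul_cos (hω : ω ∈ Ioo (-(π / 2)) (π / 2)) (hmod : modulus ω = β) :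
    (β / 2 - mercator ω) * cos ω = tan ω - 2 * ω := by
  have hcos := (cos_pos_of_mem_Ioo hω).ne'
  rw [← hmod, modulus]
  field_simp
  ring

theorem mercator_le_of_modulus_eq (hω : ω ∈ Ioo (-(π / 2)) (π / 2)) (hmod : modulus ω = β)
    (htan : 2 * ω ≤ tan ω) : mercator ω ≤ β / 2 := by
  rw [← sub_nonneg, ← mul_nonneg_iff_of_pos_right (cos_pos_of_mem_Ioo hω),
    half_sub_mercator_mul_cos hω hmod]
  exact sub_nonneg.2 htan

theorem arcLen_mercator_eq_tan_sub (hβ : 0 < β) (hω : ω ∈ Ioo 0 (π / 2)) (hmod : modulus ω = β)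
    (htan : 2 * ω ≤ tan ω) : arcLen β (mercator ω) (β / 2) = tan ω - ω := by
  have hω' := Ioo_zero_subset hω
  rw [arcLen_mercator_half hβ hω (mercator_le_of_modulus_eq hω' hmod htan),
    half_sub_mercator_mul_cos hω' hmod]
  ring

theorem isBalanced_flatSpherical (hβ : 0 < β) (hω : ω ∈ Ioo 0 (π / 2)) (hmod : modulus ω = β)
    (htan : 2 * ω ≤ tan ω) : IsBalanced β ω (cos ω) where
  mem_Ioo := hω
  mercator_le := mercator_le_of_modulus_eq (Ioo_zero_subset hω) hmod htan
  slope_pos := cos_pos_of_mem_Ioo (Ioo_zero_subset hω)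
  slope_le := le_rfl
  sin_eq := by
    rw [arcLen_mercator_eq_tan_sub hβ hω hmod htan, add_sub_cancel, mul_comm,
      tan_mul_cos (cos_pos_of_mem_Ioo (Ioo_zero_subset hω)).ne']
  slackness := by rw [sub_self, mul_zero]

theorem isFlatSpherical_extremal_of_modulus_eq (hβ : 0 < β) (hω : ω ∈ Ioo 0 (π / 2))
    (hmod : modulus ω = β) (htan : 2 * ω ≤ tan ω) :
    (extremal β (mercator ω)).IsFlatSpherical (tan ω - ω) ω :=
  arcLen_mercator_eq_tan_sub hβ hω hmod htan ▸ isFlatSpherical_extremal_mercator hβ hω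
    (mercator_le_of_modulus_eq (Ioo_zero_subset hω) hmod htan)

end FlatSpherical

end Klein

end

theorem theorem1 (b₀ : ℝ) (hb₀ : b₀ ∈ Set.Ioo 0 (Real.pi / 2)) (htan : Real.tan b₀ = 2 * b₀)
    (β : ℝ) (hβ : 0 < β) :
    (β ≤ 2 * Real.log (Real.tan (Real.pi / 4 + b₀ / 2)) →
      (∀ g : Klein.RiemMetric β, g.Conformal (Klein.flat β) →
        g.lv * g.lσ ≤
          Real.arcsin ((Real.exp β - 1) / (Real.exp β + 1)) /
            ((Real.exp β - 1) / (Real.exp β + 1)) * g.vol) ∧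
      ∃ b ∈ Set.Ioc 0 b₀, β = 2 * Real.log (Real.tan (Real.pi / 4 + b / 2)) ∧
        ∃ g : Klein.RiemMetric β, g.Conformal (Klein.flat β) ∧ g.IsSpherical b ∧
          g.lv * g.lσ =
            Real.arcsin ((Real.exp β - 1) / (Real.exp β + 1)) /
              ((Real.exp β - 1) / (Real.exp β + 1)) * g.vol) ∧
    (2 * Real.log (Real.tan (Real.pi / 4 + b₀ / 2)) < β →
      ∃ ω ∈ Set.Ico b₀ (Real.pi / 2),
        (∀ ω' ∈ Set.Ico b₀ (Real.pi / 2),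
          2 * Real.sin ω' =
            (β - 2 * Real.log (Real.tan (Real.pi / 4 + ω' / 2))) * Real.cos ω' ^ 2 +
              4 * ω' * Real.cos ω' ↔ ω' = ω) ∧
        (∀ g : Klein.RiemMetric β, g.Conformal (Klein.flat β) →
          g.lv * g.lσ ≤ 1 / (2 * Real.cos ω) * g.vol) ∧
        ∃ b, ω < b ∧ Real.tan ω = b + ω ∧
          ∃ g : Klein.RiemMetric β, g.Conformal (Klein.flat β) ∧ g.IsFlatSpherical b ω ∧
            g.lv * g.lσ = 1 / (2 * Real.cos ω) * g.vol) := by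
  rw [Klein.log_tan_eq_mercator (Klein.Ioo_zero_subset hb₀)]
  refine ⟨fun hle => ?_, fun hlt => ?_⟩
  · obtain ⟨b, hb, hbβ⟩ := Klein.exists_mercator_eq hb₀ hβ hle
    have hb' : b ∈ Set.Ioo 0 (Real.pi / 2) := ⟨hb.1, hb.2.trans_lt hb₀.2⟩
    have hbal := Klein.isBalanced_spherical hβ hb' hbβ (Klein.tan_le_two_mul_of_le hb₀ htan hb)
    rw [Klein.arcsin_div_self_eq hb' hbβ]
    refine ⟨fun _ => hbal.lv_mul_lσ_le, b, hb, ?_, Klein.extremal β (Klein.mercator b),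
      Klein.conformal_extremal, Klein.isSpherical_extremal hβ hb' hbβ, hbal.extremal_lv_mul_lσ⟩
    rw [Klein.log_tan_eq_mercator (Klein.Ioo_zero_subset hb'), hbβ, mul_div_cancel₀ β two_ne_zero]
  · obtain ⟨ω, hω, hmod⟩ := Klein.exists_modulus_eq hb₀ htan hlt
    have hω' : ω ∈ Set.Ioo 0 (Real.pi / 2) := ⟨hb₀.1.trans hω.1, hω.2⟩
    have hgap := Klein.two_mul_lt_tan_of_lt hb₀ htan hω
    have hbal := Klein.isBalanced_flatSpherical hβ hω' hmod hgap.le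
    refine ⟨ω, Set.Ioo_subset_Ico_self hω, fun ω₁ hω₁ => ?_, fun _ => hbal.lv_mul_lσ_le,
      Real.tan ω - ω, by linarith, by ring, Klein.extremal β (Klein.mercator ω),
      Klein.conformal_extremal, Klein.isFlatSpherical_extremal_of_modulus_eq hβ hω' hmod hgap.le,
      hbal.extremal_lv_mul_lσ⟩
    rw [Klein.flatSpherical_equation_iff
      (Klein.Ioo_zero_subset ⟨hb₀.1.trans_le hω₁.1, hω₁.2⟩), ← hmod]
    exact (Klein.strictMonoOn_modulus hb₀ htan).injOn.eq_iff hω₁ (Set.Ioo_subset_Ico_self hω)
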